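/- Let $h \ge 1$ and $\ell \ge 0$ be fixed integers, and let $K_h + I_\ell$ be the disjoint union of a clique on $h$ vertices and $\ell$ isolated vertices. In the $(K_h+I_\ell)$-S-Deletion problem, one is given a finite simple graph $G$ and asks for the minimum size of a set $X \subseteq V(G)$ that meets the image of every injective homomorphism from $K_h+I_\ell$ to $G$ (equivalently, such that $G \setminus X$ contains no subgraph, induced or not, isomorphic to $K_h + I_\ell$). There is an algorithm that, given $G$ together with a tree decomposition of $G$, computes this minimum in time $\mathcal{O}^*(2^{\mathcal{O}(t)})$, where $t$ is the width of the given tree decomposition. That is, there are constants $C, c, d$ depending only on $h$ and $\ell$ such that the algorithm runs in at most $C \cdot 2^{c t} \cdot N^{d}$ steps of a random access machine (with addition and subtraction as its arithmetic, at unit cost), where $N$ is the size of the input, consisting of the graph and the tree decomposition. (For the graph without vertices, $t$ is read as $0$.) -/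

import Mathlib

/-! ## Random access machines

A machine has registers `reg 0, reg 1, …` (a program names only finitely many of them) and a memory
`mem 0, mem 1, …` that is addressed through the registers; both hold natural numbers. Every basic
instruction and every evaluated test costs one step. The only arithmetic is addition and truncated
subtraction, so that this unit-cost measure is polynomially equivalent to Turing machine time. -/

namespace RAM

structure State where
  reg : ℕ → ℕ
  mem : ℕ → ℕ

/-- Programs. The arguments `r a b` are register names, and `c` is a constant of the program. -/
inductive Program where
  /-- no operation -/
  | skip : Program
  /-- `reg r := c` -/
  | const (r c : ℕ) : Program
  /-- `reg r := reg a` -/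
  | move (r a : ℕ) : Program
  /-- `reg r := reg a + reg b` -/
  | add (r a b : ℕ) : Program
  /-- `reg r := max (reg a - reg b) 0` -/
  | sub (r a b : ℕ) : Program
  /-- `reg r := mem (reg a)` -/
  | load (r a : ℕ) : Program
  /-- `mem (reg a) := reg r` -/
  | store (a r : ℕ) : Program
  /-- run `P`, then `Q` -/
  | seq (P Q : Program) : Program
  /-- if `reg r ≠ 0` run `P`, otherwise run `Q` -/
  | ite (r : ℕ) (P Q : Program) : Program
  /-- as long as `reg r ≠ 0`, run `P` -/
  | loop (r : ℕ) (P : Program) : Program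

def State.setReg (s : State) (r x : ℕ) : State :=
  { s with reg := Function.update s.reg r x }

def State.setMem (s : State) (i x : ℕ) : State :=
  { s with mem := Function.update s.mem i x }

/-- `Exec P s T s'`: the program `P`, started in the state `s`, halts after exactly `T` steps,
and the state is then `s'`. -/
inductive Exec : Program → State → ℕ → State → Prop where
  | skip (s : State) : Exec .skip s 1 s
  | const (r c : ℕ) (s : State) : Exec (.const r c) s 1 (s.setReg r c)
  | move (r a : ℕ) (s : State) : Exec (.move r a) s 1 (s.setReg r (s.reg a))
  | add (r a b : ℕ) (s : State) : Exec (.add r a b) s 1 (s.setReg r (s.reg a + s.reg b))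
  | sub (r a b : ℕ) (s : State) : Exec (.sub r a b) s 1 (s.setReg r (s.reg a - s.reg b))
  | load (r a : ℕ) (s : State) : Exec (.load r a) s 1 (s.setReg r (s.mem (s.reg a)))
  | store (a r : ℕ) (s : State) : Exec (.store a r) s 1 (s.setMem (s.reg a) (s.reg r))
  | seq {P Q : Program} {s s₁ s₂ : State} {T₁ T₂ : ℕ} :
      Exec P s T₁ s₁ → Exec Q s₁ T₂ s₂ → Exec (.seq P Q) s (T₁ + T₂) s₂
  | ite_true {r : ℕ} {P Q : Program} {s s' : State} {T : ℕ} :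
      s.reg r ≠ 0 → Exec P s T s' → Exec (.ite r P Q) s (1 + T) s'
  | ite_false {r : ℕ} {P Q : Program} {s s' : State} {T : ℕ} :
      s.reg r = 0 → Exec Q s T s' → Exec (.ite r P Q) s (1 + T) s'
  | loop_true {r : ℕ} {P : Program} {s s₁ s₂ : State} {T₁ T₂ : ℕ} :
      s.reg r ≠ 0 → Exec P s T₁ s₁ → Exec (.loop r P) s₁ T₂ s₂ →
        Exec (.loop r P) s (1 + T₁ + T₂) s₂
  | loop_false {r : ℕ} {P : Program} {s : State} :
      s.reg r = 0 → Exec (.loop r P) s 1 s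

/-- The initial state on input `x`: the list `x` stands in the memory cells `0, …, x.length - 1`,
its length in register `0`, and everything else is `0`. -/
def init (x : List ℕ) : State where
  reg := Function.update (fun _ => 0) 0 x.length
  mem := fun i => x.getD i 0

/-- On input `x` the program `P` halts within `B` steps with the number `y` in register `0`. -/
def OutputsWithin (P : Program) (x : List ℕ) (y B : ℕ) : Prop :=
  ∃ (T : ℕ) (s : State), Exec P (init x) T s ∧ T ≤ B ∧ s.reg 0 = y

end RAM

/-! ## Tree decompositions -/

/-- Tree decompositions of `G` whose tree has the node set `W`. -/
structure TreeDecomposition {V : Type*} (G : SimpleGraph V) (W : Type*) where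
  tree : SimpleGraph W
  isTree : tree.IsTree
  bag : W → Finset V
  exists_mem_bag : ∀ v : V, ∃ w : W, v ∈ bag w
  exists_edge_bag : ∀ u v : V, G.Adj u v → ∃ w : W, u ∈ bag w ∧ v ∈ bag w
  mem_bag_of_path : ∀ (x y z : W) (p : tree.Walk x y), p.IsPath → z ∈ p.support →
    ∀ v : V, v ∈ bag x → v ∈ bag y → v ∈ bag z

/-- The maximum size of a bag minus one (read as `0` if all bags are empty, which happens only for
the graph without vertices). -/
def TreeDecomposition.width {V W : Type*} [Fintype W] {G : SimpleGraph V}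
    (D : TreeDecomposition G W) : ℕ :=
  (Finset.univ.sup fun w => (D.bag w).card) - 1

/-! ## Encoding of the input -/

open Classical in
/-- The `a × b` matrix with entries `0` and `1` of a relation, row by row. -/
noncomputable def encodeRel {a b : ℕ} (R : Fin a → Fin b → Prop) : List ℕ :=
  (List.finRange a).flatMap fun i => (List.finRange b).map fun j => if R i j then 1 else 0

/-- A graph on `n` vertices with a tree decomposition with `m` nodes is written as `n`, `m`, the
adjacency matrix of the graph, the adjacency matrix of the tree, and the incidence matrix of nodes
and vertices that describes the bags. -/
noncomputable def encodeInput {n m : ℕ} (G : SimpleGraph (Fin n))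
    (D : TreeDecomposition G (Fin m)) : List ℕ :=
  n :: m :: (encodeRel G.Adj ++ encodeRel D.tree.Adj ++ encodeRel fun w v => v ∈ D.bag w)

/-! ## Hitting sets -/

/-- The disjoint union `K_h + I_l` of a clique on `h` vertices and `l` isolated vertices. -/
def cliquePlusIndep (h l : ℕ) : SimpleGraph (Fin h ⊕ Fin l) :=
  SimpleGraph.sum (⊤ : SimpleGraph (Fin h)) (⊥ : SimpleGraph (Fin l))

/-- `X` hits all (not necessarily induced) `H`-subgraphs of `G`, that is, the image of every
injective homomorphism from `H` to `G`. -/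
def HitsAllCopies {U V : Type*} (H : SimpleGraph U) (G : SimpleGraph V) (X : Finset V) : Prop :=
  ∀ f : H →g G, Function.Injective f → ∃ u : U, f u ∈ X

/-- `k` is the minimum size of a set that hits all `H`-subgraphs of `G`. -/
def IsMinHittingSize {U V : Type*} (H : SimpleGraph U) (G : SimpleGraph V) (k : ℕ) : Prop :=
  IsLeast {j : ℕ | ∃ X : Finset V, HitsAllCopies H G X ∧ X.card = j} k

/-! ## Reasoning about programs -/

/-! A set `X` meets every copy of `K_h + I_l` exactly if it meets every `h`-clique or leaves fewer
than `h + l` vertices: an `h`-clique avoiding `X` extends to a copy by any `l` further remaining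
vertices (`hitsAllCopies_cliquePlusIndep_iff`). Hence the optimum is the smaller of `n - (h + l -
1)` and the minimum size `k` of a set that meets all `h`-cliques
(`isMinHittingSize_cliquePlusIndep`).

The number `k` comes from dynamic programming. Every clique lies in a bag, so it suffices to choose
in every bag a subset that meets the `h`-cliques of the bag, such that choices at adjacent nodes
agree on common vertices. By `isTable_weight`, `k` is the minimum total weight of a consistent
choice, where a vertex is counted only at its first node and a missed clique costs `n + 1`. Removing
a leaf and adding to each entry of its neighbour the cheapest compatible entry of the leaf preserves
this minimum (`IsTable.erase`), and the last remaining row has minimum `k` (`IsTable.isLeast`).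

The running time needs no careful count. The algorithm is written in a small language whose only
loops are `for` loops bounded by variables, and its translation into RAM programs is correct with a
cost polynomial in any bound `B` for the variables (`Stmt.runs_code`, `Stmt.polyBounded_cost`). The
variables are bounded by the input size `N` or by the number of codes for subsets of a bag, which is
at most `2 ^ (t + 1)`. So `B = 2 ^ (t + 1) * N` works, and brute force over codes and repeated
recomputation are affordable. -/

namespace RAM

/-- Started in `s`, the program `P` halts within `B` steps in a state that satisfies `R`. -/
def Runs (P : Program) (s : State) (B : ℕ) (R : State → Prop) : Prop :=
  ∃ (T : ℕ) (s' : State), Exec P s T s' ∧ T ≤ B ∧ R s'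

namespace Runs

variable {P Q : Program} {s : State} {B B₁ B₂ r : ℕ} {R R₁ R₂ : State → Prop}

theorem mono (hP : Runs P s B₁ R₁) (hB : B₁ ≤ B₂) (hR : ∀ s', R₁ s' → R₂ s') :
    Runs P s B₂ R₂ := by
  obtain ⟨T, s', h, hT, hs⟩ := hP
  exact ⟨T, s', h, hT.trans hB, hR s' hs⟩

theorem seq (hP : Runs P s B₁ R₁) (hQ : ∀ s', R₁ s' → Runs Q s' B₂ R₂) :
    Runs (.seq P Q) s (B₁ + B₂) R₂ := by
  obtain ⟨T, s', h, hT, hs⟩ := hP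
  obtain ⟨T', s'', h', hT', hs'⟩ := hQ s' hs
  exact ⟨_, s'', .seq h h', by omega, hs'⟩

theorem skip (h : R s) : Runs .skip s 1 R := ⟨1, _, .skip s, le_rfl, h⟩

theorem const {c : ℕ} (h : R (s.setReg r c)) : Runs (.const r c) s 1 R :=
  ⟨1, _, .const r c s, le_rfl, h⟩

theorem move {a : ℕ} (h : R (s.setReg r (s.reg a))) : Runs (.move r a) s 1 R :=
  ⟨1, _, .move r a s, le_rfl, h⟩

theorem add {a b : ℕ} (h : R (s.setReg r (s.reg a + s.reg b))) : Runs (.add r a b) s 1 R :=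
  ⟨1, _, .add r a b s, le_rfl, h⟩

theorem sub {a b : ℕ} (h : R (s.setReg r (s.reg a - s.reg b))) : Runs (.sub r a b) s 1 R :=
  ⟨1, _, .sub r a b s, le_rfl, h⟩

theorem load {a : ℕ} (h : R (s.setReg r (s.mem (s.reg a)))) : Runs (.load r a) s 1 R :=
  ⟨1, _, .load r a s, le_rfl, h⟩

theorem store {a : ℕ} (h : R (s.setMem (s.reg a) (s.reg r))) : Runs (.store a r) s 1 R :=
  ⟨1, _, .store a r s, le_rfl, h⟩

theorem ite (h₁ : s.reg r ≠ 0 → Runs P s B R) (h₂ : s.reg r = 0 → Runs Q s B R) :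
    Runs (.ite r P Q) s (1 + B) R := by
  by_cases h : s.reg r = 0
  · obtain ⟨T, s', hE, hT, hs⟩ := h₂ h
    exact ⟨_, s', .ite_false h hE, by omega, hs⟩
  · obtain ⟨T, s', hE, hT, hs⟩ := h₁ h
    exact ⟨_, s', .ite_true h hE, by omega, hs⟩

/-- A loop with the invariant `I`, whose argument is the number of remaining iterations. -/
theorem loop (I : ℕ → State → Prop) (h0 : ∀ s, I 0 s → s.reg r = 0)
    (hI : ∀ i s, I (i + 1) s → s.reg r ≠ 0 ∧ Runs P s B (I i)) (k : ℕ) (hs : I k s) :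
    Runs (.loop r P) s (k * (B + 1) + 1) (I 0) := by
  induction k generalizing s with
  | zero => exact ⟨1, s, .loop_false (h0 s hs), by omega, hs⟩
  | succ k ih =>
    obtain ⟨hr, T, s', hE, hT, hs'⟩ := hI k s hs
    obtain ⟨T', s'', hE', hT', hs''⟩ := ih hs'
    refine ⟨_, s'', .loop_true hr hE hE', ?_, hs''⟩
    rw [Nat.succ_mul]
    omega

end Runs

@[simp] theorem State.setReg_reg (s : State) (r x : ℕ) :
    (s.setReg r x).reg = Function.update s.reg r x := rfl
@[simp] theorem State.setReg_mem (s : State) (r x : ℕ) : (s.setReg r x).mem = s.mem := rfl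
@[simp] theorem State.setMem_reg (s : State) (r x : ℕ) : (s.setMem r x).reg = s.reg := rfl
@[simp] theorem State.setMem_mem (s : State) (r x : ℕ) :
    (s.setMem r x).mem = Function.update s.mem r x := rfl

/-! ## Expressions and statements -/

/-- The result of the loop `for i = 0, …, n - 1: a := f i a`. -/
def iter {α : Type*} (n : ℕ) (f : ℕ → α → α) (a : α) : α :=
  Nat.rec a f n

@[simp] theorem iter_zero {α : Type*} (f : ℕ → α → α) (a : α) : iter 0 f a = a := rfl
@[simp] theorem iter_succ {α : Type*} (n : ℕ) (f : ℕ → α → α) (a : α) :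
    iter (n + 1) f a = f n (iter n f a) := rfl

theorem iter_congr {α : Type*} {n : ℕ} {f g : ℕ → α → α} {a : α}
    (h : ∀ i < n, ∀ b, f i b = g i b) : iter n f a = iter n g a := by
  induction n with
  | zero => rfl
  | succ n ih =>
    rw [iter_succ, iter_succ, ih fun i hi => h i (by omega), h n (by omega)]

/-- To establish an invariant after a loop. -/
theorem iter_induction {α : Type*} {n : ℕ} {f : ℕ → α → α} {a : α} (I : ℕ → α → Prop)
    (h0 : I 0 a) (h : ∀ i < n, ∀ b, I i b → I (i + 1) (f i b)) : I n (iter n f a) := by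
  induction n with
  | zero => exact h0
  | succ n ih => exact h n (by omega) _ (ih fun i hi => h i (by omega))

/-- Binary operations. -/
inductive Op where
  | add | sub | min | max
  /-- double the first argument if the second one is not `0` -/
  | dbl
  /-- subtract the second argument if possible -/
  | csub

namespace Op

def eval : Op → ℕ → ℕ → ℕ
  | add, a, b => a + b
  | sub, a, b => a - b
  | min, a, b => Min.min a b
  | max, a, b => Max.max a b
  | dbl, a, b => if b = 0 then a else a + a
  | csub, a, b => if b ≤ a then a - b else a

/-- Replace the contents of register `k` by the result of the operation applied to the registers
`k` and `k + 1`. -/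
def code (k : ℕ) : Op → Program
  | add => .add k k (k + 1)
  | sub => .sub k k (k + 1)
  -- Truncated subtraction yields `min a b = a - (a - b)` and `max a b = a + (b - a)`.
  | min => .seq (.sub (k + 2) k (k + 1)) (.sub k k (k + 2))
  | max => .seq (.sub (k + 2) (k + 1) k) (.add k k (k + 2))
  | dbl => .ite (k + 1) (.add k k k) .skip
  | csub => .seq (.sub (k + 2) (k + 1) k) (.ite (k + 2) .skip (.sub k k (k + 1)))

theorem runs_code (o : Op) (k : ℕ) (s : State) :
    Runs (o.code k) s 3 fun s' => s'.mem = s.mem ∧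
      s'.reg k = o.eval (s.reg k) (s.reg (k + 1)) ∧ ∀ j < k, s'.reg j = s.reg j := by
  have hlt : ∀ j < k, j ≠ k ∧ j ≠ k + 1 ∧ j ≠ k + 2 := by omega
  cases o with
  | add => exact (Runs.add (R := fun s' => s'.mem = s.mem ∧ _) (by
      simp +contextual [eval, hlt])).mono (by omega) fun _ h => h
  | sub => exact (Runs.sub (R := fun s' => s'.mem = s.mem ∧ _) (by
      simp +contextual [eval, hlt])).mono (by omega) fun _ h => h
  | min =>
    refine (Runs.seq (Runs.sub (R := (· = _)) rfl) ?_).mono (show 1 + 1 ≤ 3 by omega) fun _ h => h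
    rintro _ rfl
    refine Runs.sub ?_
    simp +contextual [eval, hlt]
    omega
  | max =>
    refine (Runs.seq (Runs.sub (R := (· = _)) rfl) ?_).mono (show 1 + 1 ≤ 3 by omega) fun _ h => h
    rintro _ rfl
    refine Runs.add ?_
    simp +contextual [eval, hlt]
    omega
  | dbl =>
    refine (Runs.ite (B := 1) (fun h => Runs.add ?_) fun h => Runs.skip ?_).mono
      (by omega) fun _ h => h
    · simp +contextual [eval, hlt, h]
    · simp +contextual [eval, h]
  | csub =>
    refine (Runs.seq (Runs.sub (R := (· = _)) rfl) ?_).mono (show 1 + (1 + 1) ≤ 3 by omega)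
      fun _ h => h
    rintro _ rfl
    refine Runs.ite (fun h => Runs.skip ?_) fun h => Runs.sub ?_
    · simp +contextual [eval, hlt] at h ⊢
      omega
    · simp +contextual [eval, hlt] at h ⊢
      omega

end Op

/-- Expressions over variables, which are registers, and the memory. -/
inductive Expr where
  | const (c : ℕ) : Expr
  | var (x : ℕ) : Expr
  | mem (e : Expr) : Expr
  | bin (o : Op) (e₁ e₂ : Expr) : Expr
  /-- `e₁` if `e ≠ 0` and `e₂` otherwise -/
  | ite (e e₁ e₂ : Expr) : Expr
  /-- the value of `a` after `a := init; for x < b: a := o a body`, where `b` is a variable -/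
  | fold (o : Op) (x b : ℕ) (init body : Expr) : Expr

namespace Expr

def eval (M : ℕ → ℕ) : Expr → (ℕ → ℕ) → ℕ
  | const c, _ => c
  | var x, ρ => ρ x
  | mem e, ρ => M (e.eval M ρ)
  | bin o e₁ e₂, ρ => o.eval (e₁.eval M ρ) (e₂.eval M ρ)
  | ite e e₁ e₂, ρ => if e.eval M ρ ≠ 0 then e₁.eval M ρ else e₂.eval M ρ
  | fold o x b init body, ρ =>
    iter (ρ b) (fun i a => o.eval a (body.eval M (Function.update ρ x i))) (init.eval M ρ)

/-- All variables of the expression are less than `k`. -/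
def Below (k : ℕ) : Expr → Prop
  | const _ => True
  | var x => x < k
  | mem e => e.Below k
  | bin _ e₁ e₂ => e₁.Below k ∧ e₂.Below k
  | ite e e₁ e₂ => e.Below k ∧ e₁.Below k ∧ e₂.Below k
  | fold _ x b init body => x < k ∧ b < k ∧ init.Below k ∧ body.Below k

/-- Registers from `k` on serve as scratch space, so values must not depend on them. -/
theorem eval_congr (M : ℕ → ℕ) {e : Expr} {k : ℕ} (h : e.Below k) {ρ ρ' : ℕ → ℕ}
    (hρ : ∀ j < k, ρ j = ρ' j) : e.eval M ρ = e.eval M ρ' := by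
  induction e generalizing ρ ρ' with
  | const => rfl
  | var x => exact hρ x h
  | mem e ih => simp only [eval, ih h hρ]
  | bin o e₁ e₂ ih₁ ih₂ => simp only [eval, ih₁ h.1 hρ, ih₂ h.2 hρ]
  | ite e e₁ e₂ ih ih₁ ih₂ => simp only [eval, ih h.1 hρ, ih₁ h.2.1 hρ, ih₂ h.2.2 hρ]
  | fold o x b e₁ e₂ ih₁ ih₂ =>
    simp only [eval, ih₁ h.2.2.1 hρ, hρ b h.2.1]
    refine iter_congr fun i _ a => ?_
    rw [ih₂ h.2.2.2]
    intro j hj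
    by_cases hjx : j = x
    · subst hjx; simp
    · simp [hjx, hρ j hj]

/-- A program that computes the expression in register `k`, with the registers after `k` as a
work space. -/
def code : Expr → ℕ → Program
  | const c, k => .const k c
  | var x, k => .move k x
  | mem e, k => .seq (e.code k) (.load k k)
  | bin o e₁ e₂, k => .seq (e₁.code k) (.seq (e₂.code (k + 1)) (o.code k))
  | ite e e₁ e₂, k => .seq (e.code k) (.ite k (e₁.code k) (e₂.code k))
  | fold o x b init body, k =>
    -- Register `k` saves the old value of `x`, `k + 1` counts the remaining rounds, and `k + 2`
    -- accumulates the result; `x` is restored at the end.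
    .seq (.move k x) <| .seq (.move (k + 1) b) <| .seq (init.code (k + 2)) <|
    .seq (.const x 0) <| .seq
      (.loop (k + 1) <|
        .seq (body.code (k + 3)) <| .seq (o.code (k + 2)) <| .seq (.const (k + 3) 1) <|
        .seq (.add x x (k + 3)) (.sub (k + 1) (k + 1) (k + 3))) <|
    .seq (.move x k) (.move k (k + 2))

/-- A bound for the running time if no variable exceeds `B`. -/
def cost (B : ℕ) : Expr → ℕ
  | const _ => 1
  | var _ => 1
  | mem e => e.cost B + 1
  | bin _ e₁ e₂ => e₁.cost B + (e₂.cost B + 3)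
  | ite e e₁ e₂ => e.cost B + (1 + (e₁.cost B + e₂.cost B))
  | fold _ _ _ init body =>
    1 + (1 + (init.cost B + (1 + ((B * (body.cost B + (3 + (1 + (1 + 1))) + 1) + 1) + (1 + 1)))))

/-- What the code of an expression does. -/
def Post (e : Expr) (k : ℕ) (s s' : State) : Prop :=
  s'.mem = s.mem ∧ s'.reg k = e.eval s.mem s.reg ∧ ∀ j < k, s'.reg j = s.reg j

theorem runs_code {e : Expr} {K B : ℕ} (he : e.Below K) (k : ℕ) (hk : K ≤ k) (s : State)
    (hB : ∀ j < K, s.reg j ≤ B) : Runs (e.code k) s (e.cost B) (e.Post k s) := by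
  revert k s
  induction e with
  | const c =>
    intro k hk s hB
    refine Runs.const ⟨rfl, by simp [eval], fun j hj => ?_⟩
    simp [hj.ne]
  | var x =>
    intro k hk s hB
    refine Runs.move ⟨rfl, by simp [eval], fun j hj => ?_⟩
    simp [hj.ne]
  | mem e ih =>
    intro k hk s hB
    refine Runs.seq (ih he k hk s hB) fun s₁ ⟨hm, hv, hr⟩ => Runs.load ⟨hm, ?_, fun j hj => ?_⟩
    · simp [eval, hm, hv]
    · simp [hj.ne, hr j hj]
  | bin o e₁ e₂ ih₁ ih₂ =>
    intro k hk s hB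
    refine Runs.seq (ih₁ he.1 k hk s hB) fun s₁ ⟨hm₁, hv₁, hr₁⟩ => ?_
    refine Runs.seq (ih₂ he.2 (k + 1) (by omega) s₁
      fun j hj => (hr₁ j (by omega)).trans_le (hB j hj)) fun s₂ ⟨hm₂, hv₂, hr₂⟩ => ?_
    refine (o.runs_code k s₂).mono le_rfl fun s₃ ⟨hm₃, hv₃, hr₃⟩ => ⟨?_, ?_, fun j hj => ?_⟩
    · rw [hm₃, hm₂, hm₁]
    · rw [hv₃, hv₂, hr₂ k (by omega), hv₁, hm₁, eval,
        eval_congr _ he.2 fun j hj => hr₁ j (by omega)]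
    · rw [hr₃ j hj, hr₂ j (by omega), hr₁ j hj]
  | ite e e₁ e₂ ih ih₁ ih₂ =>
    intro k hk s hB
    refine Runs.seq (ih he.1 k hk s hB) fun s₁ ⟨hm₁, hv₁, hr₁⟩ => ?_
    have hB₁ : ∀ j < K, s₁.reg j ≤ B := fun j hj => (hr₁ j (by omega)).trans_le (hB j hj)
    refine Runs.ite (fun h => ?_) fun h => ?_
    · refine (ih₁ he.2.1 k hk s₁ hB₁).mono (by omega)
        fun s₂ ⟨hm₂, hv₂, hr₂⟩ => ⟨by rw [hm₂, hm₁], ?_, fun j hj => by rw [hr₂ j hj, hr₁ j hj]⟩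
      rw [hv₂, eval, if_pos (hv₁ ▸ h), hm₁, eval_congr _ he.2.1 fun j hj => hr₁ j (by omega)]
    · refine (ih₂ he.2.2 k hk s₁ hB₁).mono (by omega)
        fun s₂ ⟨hm₂, hv₂, hr₂⟩ => ⟨by rw [hm₂, hm₁], ?_, fun j hj => by rw [hr₂ j hj, hr₁ j hj]⟩
      rw [hv₂, eval, if_neg (by rw [← hv₁, h]; simp), hm₁,
        eval_congr _ he.2.2 fun j hj => hr₁ j (by omega)]
  | fold o x b e₁ e₂ ih₁ ih₂ =>
    intro k hk s hB
    obtain ⟨hx, hb, he₁, he₂⟩ := he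
    refine Runs.seq (Runs.move (R := (· = _)) rfl) ?_
    rintro _ rfl
    refine Runs.seq (Runs.move (R := (· = _)) rfl) ?_
    rintro _ rfl
    have hlt : ∀ j < k, j ≠ k ∧ j ≠ k + 1 := by omega
    refine Runs.seq (ih₁ he₁ (k + 2) (by omega) _ fun j hj => ?_) fun s₁ ⟨hm₁, hv₁, hr₁⟩ => ?_
    · simpa [hlt j (by omega)] using hB j hj
    replace hv₁ : s₁.reg (k + 2) = e₁.eval s.mem s.reg :=
      hv₁.trans <| eval_congr _ he₁ fun j hj => by simp [hlt j (by omega)]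
    replace hm₁ : s₁.mem = s.mem := hm₁
    have hk₁ : s₁.reg k = s.reg x := by
      simpa using hr₁ k (by omega)
    have hk₂ : s₁.reg (k + 1) = s.reg b := by
      simpa [show b ≠ k by omega] using hr₁ (k + 1) (by omega)
    replace hr₁ : ∀ j < k, s₁.reg j = s.reg j := fun j hj => by
      simpa [hlt j hj] using hr₁ j (by omega)
    refine Runs.seq (Runs.const (R := (· = _)) rfl) ?_
    rintro _ rfl
    -- With `c` rounds left, `s.reg b - c` rounds are done, and this is also the current value of
    -- `x`.
    let I : ℕ → State → Prop := fun c s' => s'.mem = s.mem ∧ s'.reg k = s.reg x ∧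
      s'.reg (k + 1) = c ∧ c ≤ s.reg b ∧ s'.reg (k + 2) = iter (s.reg b - c)
        (fun i a => o.eval a (e₂.eval s.mem (Function.update s.reg x i))) (e₁.eval s.mem s.reg) ∧
      ∀ j < k, s'.reg j = Function.update s.reg x (s.reg b - c) j
    refine Runs.seq (((Runs.loop (B := e₂.cost B + (3 + (1 + (1 + 1)))) I
      (fun s h => h.2.2.1) ?_ (s.reg b) ?_).mono ?_ fun _ h => h)) ?_
    · rintro c s₂ ⟨hm, h0, h1, hc, h2, hr⟩
      refine ⟨by omega, ?_⟩
      have hlt : s.reg b - (c + 1) < B := by have := hB b hb; omega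
      refine Runs.seq (ih₂ he₂ (k + 3) (by omega) s₂ fun j hj => ?_)
        fun s₃ ⟨hm₃, hv₃, hr₃⟩ => ?_
      · rw [hr j (by omega)]
        by_cases hjx : j = x
        · subst hjx; simpa using hlt.le
        · simpa [hjx] using hB j hj
      refine Runs.seq (o.runs_code (k + 2) s₃) fun s₄ ⟨hm₄, hv₄, hr₄⟩ => ?_
      refine Runs.seq (Runs.const (R := (· = _)) rfl) ?_
      rintro _ rfl
      refine Runs.seq (Runs.add (R := (· = _)) rfl) ?_
      rintro _ rfl
      refine Runs.sub ⟨by simp [hm₄, hm₃, hm], ?_, ?_, by omega, ?_, fun j hj => ?_⟩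
      · have : k ≠ x := by omega
        simp [this, hr₄ k (by omega), hr₃ k (by omega), h0]
      · have : k + 1 ≠ x := by omega
        have : k + 3 ≠ x := by omega
        simp [*, hr₄ (k + 1) (by omega), hr₃ (k + 1) (by omega)]
      · have : k + 2 ≠ x := by omega
        have h' : s.reg b - c = (s.reg b - (c + 1)) + 1 := by omega
        rw [h', iter_succ, ← h2]
        simp only [State.setReg_reg, ne_eq, Nat.add_left_cancel_iff, OfNat.ofNat_ne_one,
          not_false_eq_true, Function.update_of_ne, this, Nat.reduceEqDiff, hv₄,
          hr₃ (k + 2) (by omega), hv₃, hm]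
        rw [eval_congr _ he₂ fun j hj => hr j (by omega)]
      · have h' : s.reg b - c = (s.reg b - (c + 1)) + 1 := by omega
        have : j ≠ k + 1 := by omega
        have : j ≠ k + 3 := by omega
        have : x ≠ k + 3 := by omega
        by_cases hjx : j = x
        · subst hjx
          simp [*, hr₄ j (by omega), hr₃ j (by omega)]
        · simp [*, hr₄ j (by omega), hr₃ j (by omega)]
    · refine ⟨hm₁, ?_, ?_, le_rfl, ?_, fun j hj => ?_⟩
      · simp [show k ≠ x by omega, hk₁]
      · simp [show k + 1 ≠ x by omega, hk₂]
      · simp [show k + 2 ≠ x by omega, hv₁]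
      · by_cases hjx : j = x
        · subst hjx; simp
        · simp [hjx, hr₁ j hj]
    · gcongr
      exact hB b hb
    · rintro s₂ ⟨hm, h0, h1, hc, h2, hr⟩
      refine Runs.seq (Runs.move (R := (· = _)) rfl) ?_
      rintro _ rfl
      refine Runs.move ⟨hm, ?_, fun j hj => ?_⟩
      · simp [show k + 2 ≠ x by omega, h2, eval]
      · by_cases hjx : j = x
        · subst hjx; simp [hj.ne, h0]
        · simp [hjx, hj.ne, hr j hj]

end Expr

/-- Statements; variables are read-only, except as loop counters. -/
inductive Stmt where
  /-- `mem e₁ := e₂` -/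
  | store (e₁ e₂ : Expr) : Stmt
  | seq (S₁ S₂ : Stmt) : Stmt
  | ifThen (e : Expr) (S : Stmt) : Stmt
  /-- `for x < b: S`, where `b` is a variable -/
  | forLoop (x b : ℕ) (S : Stmt) : Stmt

namespace Stmt

/-- The memory after the execution of a statement. -/
def run : Stmt → (ℕ → ℕ) → (ℕ → ℕ) → (ℕ → ℕ)
  | store e₁ e₂, ρ, M => Function.update M (e₁.eval M ρ) (e₂.eval M ρ)
  | seq S₁ S₂, ρ, M => S₂.run ρ (S₁.run ρ M)
  | ifThen e S, ρ, M => if e.eval M ρ ≠ 0 then S.run ρ M else M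
  | forLoop x b S, ρ, M => iter (ρ b) (fun i M' => S.run (Function.update ρ x i) M') M

def Below (k : ℕ) : Stmt → Prop
  | store e₁ e₂ => e₁.Below k ∧ e₂.Below k
  | seq S₁ S₂ => S₁.Below k ∧ S₂.Below k
  | ifThen e S => e.Below k ∧ S.Below k
  | forLoop x b S => x < k ∧ b < k ∧ S.Below k

theorem run_congr {S : Stmt} {k : ℕ} (h : S.Below k) {ρ ρ' : ℕ → ℕ}
    (hρ : ∀ j < k, ρ j = ρ' j) (M : ℕ → ℕ) : S.run ρ M = S.run ρ' M := by
  induction S generalizing ρ ρ' M with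
  | store e₁ e₂ => simp only [run, Expr.eval_congr M h.1 hρ, Expr.eval_congr M h.2 hρ]
  | seq S₁ S₂ ih₁ ih₂ => simp only [run, ih₁ h.1 hρ, ih₂ h.2 hρ]
  | ifThen e S ih => simp only [run, ih h.2 hρ, Expr.eval_congr M h.1 hρ]
  | forLoop x b S ih =>
    simp only [run, hρ b h.2.1]
    refine iter_congr fun i _ a => ih h.2.2 (fun j hj => ?_) a
    by_cases hjx : j = x
    · subst hjx; simp
    · simp [hjx, hρ j hj]

def code : Stmt → ℕ → Program
  | store e₁ e₂, k => .seq (e₁.code k) (.seq (e₂.code (k + 1)) (.store k (k + 1)))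
  | seq S₁ S₂, k => .seq (S₁.code k) (S₂.code k)
  | ifThen e S, k => .seq (e.code k) (.ite k (S.code k) .skip)
  | forLoop x b S, k =>
    .seq (.move k x) <| .seq (.move (k + 1) b) <| .seq (.const x 0) <| .seq
      (.loop (k + 1) <|
        .seq (S.code (k + 2)) <| .seq (.const (k + 2) 1) <|
        .seq (.add x x (k + 2)) (.sub (k + 1) (k + 1) (k + 2)))
    (.move x k)

/-- A bound for the running time if no variable exceeds `B`. -/
def cost (B : ℕ) : Stmt → ℕ
  | store e₁ e₂ => e₁.cost B + (e₂.cost B + 1)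
  | seq S₁ S₂ => S₁.cost B + S₂.cost B
  | ifThen e S => e.cost B + (1 + (S.cost B + 1))
  | forLoop _ _ S =>
    1 + (1 + (1 + ((B * (S.cost B + (1 + (1 + 1)) + 1) + 1) + 1)))

/-- What the code of a statement does. -/
def Post (S : Stmt) (k : ℕ) (s s' : State) : Prop :=
  s'.mem = S.run s.reg s.mem ∧ ∀ j < k, s'.reg j = s.reg j

theorem runs_code {S : Stmt} {K B : ℕ} (hS : S.Below K) (k : ℕ) (hk : K ≤ k) (s : State)
    (hB : ∀ j < K, s.reg j ≤ B) : Runs (S.code k) s (S.cost B) (S.Post k s) := by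
  revert k s
  induction S with
  | store e₁ e₂ =>
    intro k hk s hB
    refine Runs.seq (Expr.runs_code hS.1 k hk s hB) fun s₁ ⟨hm₁, hv₁, hr₁⟩ => ?_
    refine Runs.seq (Expr.runs_code hS.2 (k + 1) (by omega) s₁
      fun j hj => (hr₁ j (by omega)).trans_le (hB j hj)) fun s₂ ⟨hm₂, hv₂, hr₂⟩ => ?_
    refine Runs.store ⟨?_, fun j hj => ?_⟩
    · simp only [State.setMem_mem, run]
      rw [hm₂, hm₁, hr₂ k (by omega), hv₁, hv₂, hm₁,
        Expr.eval_congr _ hS.2 fun j hj => hr₁ j (by omega)]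
    · rw [State.setMem_reg, hr₂ j (by omega), hr₁ j hj]
  | seq S₁ S₂ ih₁ ih₂ =>
    intro k hk s hB
    refine Runs.seq (ih₁ hS.1 k hk s hB) fun s₁ ⟨hm₁, hr₁⟩ => ?_
    refine (ih₂ hS.2 k hk s₁ fun j hj => (hr₁ j (by omega)).trans_le (hB j hj)).mono le_rfl
      fun s₂ ⟨hm₂, hr₂⟩ => ⟨?_, fun j hj => by rw [hr₂ j hj, hr₁ j hj]⟩
    rw [hm₂, hm₁, run, run_congr hS.2 fun j hj => hr₁ j (by omega)]
  | ifThen e S ih =>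
    intro k hk s hB
    refine Runs.seq (Expr.runs_code hS.1 k hk s hB) fun s₁ ⟨hm₁, hv₁, hr₁⟩ => ?_
    refine Runs.ite (fun h => ?_) fun h => ?_
    · refine (ih hS.2 k hk s₁ fun j hj => (hr₁ j (by omega)).trans_le (hB j hj)).mono (by omega)
        fun s₂ ⟨hm₂, hr₂⟩ => ⟨?_, fun j hj => by rw [hr₂ j hj, hr₁ j hj]⟩
      rw [hm₂, hm₁, run, if_pos (hv₁ ▸ h), run_congr hS.2 fun j hj => hr₁ j (by omega)]
    · refine (Runs.skip (R := Post _ k s) ⟨?_, hr₁⟩).mono (by omega) fun _ h => h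
      rw [hm₁, run, if_neg (by rw [← hv₁, h]; simp)]
  | forLoop x b S ih =>
    intro k hk s hB
    obtain ⟨hx, hb, hS⟩ := hS
    refine Runs.seq (Runs.move (R := (· = _)) rfl) ?_
    rintro _ rfl
    refine Runs.seq (Runs.move (R := (· = _)) rfl) ?_
    rintro _ rfl
    refine Runs.seq (Runs.const (R := (· = _)) rfl) ?_
    rintro _ rfl
    let I : ℕ → State → Prop := fun c s' => s'.reg k = s.reg x ∧
      s'.reg (k + 1) = c ∧ c ≤ s.reg b ∧ s'.mem = iter (s.reg b - c)
        (fun i M => S.run (Function.update s.reg x i) M) s.mem ∧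
      ∀ j < k, s'.reg j = Function.update s.reg x (s.reg b - c) j
    refine Runs.seq (((Runs.loop (B := S.cost B + (1 + (1 + 1))) I
      (fun s h => h.2.1) ?_ (s.reg b) ?_).mono ?_ fun _ h => h)) ?_
    · rintro c s₂ ⟨h0, h1, hc, hm, hr⟩
      refine ⟨by omega, ?_⟩
      have hlt : s.reg b - (c + 1) < B := by have := hB b hb; omega
      refine Runs.seq (ih hS (k + 2) (by omega) s₂ fun j hj => ?_) fun s₃ ⟨hm₃, hr₃⟩ => ?_
      · rw [hr j (by omega)]
        by_cases hjx : j = x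
        · subst hjx; simpa using hlt.le
        · simpa [hjx] using hB j hj
      have h' : s.reg b - c = (s.reg b - (c + 1)) + 1 := by omega
      refine Runs.seq (Runs.const (R := (· = _)) rfl) ?_
      rintro _ rfl
      refine Runs.seq (Runs.add (R := (· = _)) rfl) ?_
      rintro _ rfl
      refine Runs.sub ⟨?_, ?_, by omega, ?_, fun j hj => ?_⟩
      · have : k ≠ x := by omega
        simp [this, hr₃ k (by omega), h0]
      · have : k + 1 ≠ x := by omega
        have : k + 2 ≠ x := by omega
        simp [*, hr₃ (k + 1) (by omega)]
      · rw [h', iter_succ, ← hm]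
        exact hm₃.trans (run_congr hS (fun j hj => hr j (by omega)) _)
      · have : j ≠ k + 1 := by omega
        have : j ≠ k + 2 := by omega
        have : x ≠ k + 2 := by omega
        by_cases hjx : j = x
        · subst hjx
          simp [*, hr₃ j (by omega)]
        · simp [*, hr₃ j (by omega)]
    · refine ⟨?_, ?_, le_rfl, ?_, fun j hj => ?_⟩
      · simp [show k ≠ x by omega]
      · simp [show k + 1 ≠ x by omega, show b ≠ k by omega]
      · simp
      · by_cases hjx : j = x
        · subst hjx; simp
        · simp [hjx, show j ≠ k + 1 by omega, hj.ne]
    · gcongr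
      exact hB b hb
    · rintro s₂ ⟨h0, h1, hc, hm, hr⟩
      refine Runs.move ⟨hm, fun j hj => ?_⟩
      by_cases hjx : j = x
      · subst hjx; simp [h0]
      · simp [hjx, hr j hj]

end Stmt

/-! ## Polynomial bounds -/

/-- `f` is bounded by a monomial on the positive integers. -/
def PolyBounded (f : ℕ → ℕ) : Prop :=
  ∃ C d : ℕ, ∀ B, 1 ≤ B → f B ≤ C * B ^ d

namespace PolyBounded

theorem const (c : ℕ) : PolyBounded fun _ => c := ⟨c, 0, by simp⟩

theorem id : PolyBounded fun B => B := ⟨1, 1, by simp⟩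

theorem add {f g : ℕ → ℕ} (hf : PolyBounded f) (hg : PolyBounded g) :
    PolyBounded fun B => f B + g B := by
  obtain ⟨C, d, h⟩ := hf
  obtain ⟨C', d', h'⟩ := hg
  refine ⟨C + C', d + d', fun B hB => ?_⟩
  rw [add_mul]
  refine Nat.add_le_add ((h B hB).trans ?_) ((h' B hB).trans ?_) <;> gcongr <;> omega

theorem mul {f g : ℕ → ℕ} (hf : PolyBounded f) (hg : PolyBounded g) :
    PolyBounded fun B => f B * g B := by
  obtain ⟨C, d, h⟩ := hf
  obtain ⟨C', d', h'⟩ := hg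
  refine ⟨C * C', d + d', fun B hB => (Nat.mul_le_mul (h B hB) (h' B hB)).trans_eq ?_⟩
  ring

end PolyBounded

/-- A loop multiplies the cost of its body by `B`, up to constants, and the nesting depth is fixed
by the expression. -/
theorem Expr.polyBounded_cost (e : Expr) : PolyBounded fun B => e.cost B := by
  induction e with
  | const | var => exact .const 1
  | mem e ih => exact ih.add (.const 1)
  | bin o e₁ e₂ ih₁ ih₂ => exact ih₁.add (ih₂.add (.const 3))
  | ite e e₁ e₂ ih ih₁ ih₂ => exact ih.add ((PolyBounded.const 1).add (ih₁.add ih₂))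
  | fold o x b e₁ e₂ ih₁ ih₂ =>
    exact (PolyBounded.const 1).add <| (PolyBounded.const 1).add <| ih₁.add <|
      (PolyBounded.const 1).add <| ((PolyBounded.id.mul ((ih₂.add (.const 6)).add
        (.const 1))).add (.const 1)).add (.const 2)

theorem Stmt.polyBounded_cost (S : Stmt) : PolyBounded fun B => S.cost B := by
  induction S with
  | store e₁ e₂ => exact e₁.polyBounded_cost.add (e₂.polyBounded_cost.add (.const 1))
  | seq S₁ S₂ ih₁ ih₂ => exact ih₁.add ih₂
  | ifThen e S ih =>
    exact e.polyBounded_cost.add ((PolyBounded.const 1).add (ih.add (.const 1)))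
  | forLoop x b S ih =>
    exact (PolyBounded.const 1).add <| (PolyBounded.const 1).add <| (PolyBounded.const 1).add <|
      ((PolyBounded.id.mul ((ih.add (.const 3)).add (.const 1))).add (.const 1)).add (.const 1)

/-- Assign the value of an expression to a variable. -/
def assign (x : ℕ) (e : Expr) (k : ℕ) : Program :=
  .seq (e.code k) (.move x k)

theorem runs_assign {e : Expr} {k B : ℕ} (x : ℕ) (he : e.Below k) (s : State)
    (hB : ∀ j < k, s.reg j ≤ B) :
    Runs (assign x e k) s (e.cost B + 1) fun s' => s'.mem = s.mem ∧
      ∀ j < k, s'.reg j = Function.update s.reg x (e.eval s.mem s.reg) j := by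
  refine Runs.seq (Expr.runs_code he k le_rfl s hB) fun s₁ ⟨hm, hv, hr⟩ =>
    Runs.move ⟨hm, fun j hj => ?_⟩
  by_cases hjx : j = x
  · subst hjx; simp [hv]
  · simp [hjx, hr j hj]

end RAM

/-! ## Tree decompositions -/

section Tree

variable {W : Type*} {T : SimpleGraph W} {A : Finset W}

/-- A connected induced subgraph of a tree is itself a tree, and a tree with at least two nodes has
one of degree one. -/
theorem SimpleGraph.IsTree.exists_leaf_induce (hT : T.IsTree)
    (hA : (T.induce (A : Set W)).Connected) (hcard : 2 ≤ A.card) :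
    ∃ w ∈ A, ∃! p, p ∈ A ∧ T.Adj w p := by
  classical
  have : Nontrivial (A : Set W) := by
    have := Finset.one_lt_card_iff_nontrivial.1 hcard
    exact Set.nontrivial_coe_sort.2 this
  obtain ⟨⟨w, hw⟩, hdeg⟩ := SimpleGraph.IsTree.exists_vert_degree_one_of_nontrivial
    (G := T.induce (A : Set W)) ⟨hA, hT.isAcyclic.induce _⟩
  obtain ⟨⟨p, hp⟩, hadj, huniq⟩ := SimpleGraph.degree_eq_one_iff_existsUnique_adj.1 hdeg
  refine ⟨w, hw, p, ⟨hp, hadj⟩, fun q hq => ?_⟩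
  exact congrArg Subtype.val (huniq ⟨q, hq.1⟩ hq.2)

theorem SimpleGraph.Connected.induce_erase_leaf [DecidableEq W]
    (hA : (T.induce (A : Set W)).Connected) {w : W}
    (hw : w ∈ A) (hleaf : ∃! p, p ∈ A ∧ T.Adj w p) :
    (T.induce (A.erase w : Set W)).Connected := by
  classical
  obtain ⟨p, ⟨hp, hadj⟩, huniq⟩ := hleaf
  have hdeg : (T.induce (A : Set W)).degree ⟨w, hw⟩ = 1 :=
    SimpleGraph.degree_eq_one_iff_existsUnique_adj.2
      ⟨⟨p, hp⟩, hadj, fun q hq => Subtype.ext (huniq q ⟨q.2, hq⟩)⟩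
  have hc := hA.induce_compl_singleton_of_degree_eq_one hdeg
  let φ : (T.induce (A : Set W)).induce {⟨w, hw⟩}ᶜ →g T.induce (A.erase w : Set W) :=
    { toFun := fun x => ⟨x.1.1, by
        have h1 := x.1.2
        have h2 : x.1 ≠ ⟨w, hw⟩ := x.2
        have h3 : x.1.1 ≠ w := fun h => h2 (Subtype.ext h)
        simp_all⟩
      map_rel' := fun h => h }
  refine hc.map φ fun x => ?_
  have hx := x.2
  simp only [Finset.coe_erase, Set.mem_sdiff, Finset.mem_coe, Set.mem_singleton_iff] at hx
  exact ⟨⟨⟨x, hx.1⟩, fun h => hx.2 (congrArg Subtype.val h)⟩, rfl⟩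

end Tree

/-! ### Cliques in bags and elimination of leaves -/

namespace TreeDecomposition

variable {V W : Type*} {G : SimpleGraph V}
  (D : TreeDecomposition G W) {A : Finset W}

/-- A path from `w` to `z` inside `A` is a path of the tree, so all its bags contain `v`; its second
node is the required neighbour. -/
theorem exists_adj_mem_bag (hA : (D.tree.induce (A : Set W)).Connected) {w z : W} (hw : w ∈ A)
    (hz : z ∈ A) (hne : w ≠ z) {v : V} (hvw : v ∈ D.bag w) (hvz : v ∈ D.bag z) :
    ∃ q ∈ A, D.tree.Adj w q ∧ v ∈ D.bag q := by
  obtain ⟨q, hq⟩ := hA.exists_isPath ⟨w, hw⟩ ⟨z, hz⟩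
  have hq' := hq.map (f := (SimpleGraph.Embedding.induce (G := D.tree) (A : Set W)).toHom)
    (SimpleGraph.Embedding.induce (G := D.tree) (A : Set W)).injective
  cases q with
  | nil => exact absurd rfl hne
  | cons hadj q =>
    rename_i y
    refine ⟨y.1, y.2, hadj, D.mem_bag_of_path _ _ _ _ hq' ?_ v hvw hvz⟩
    simp only [SimpleGraph.Walk.support_map, SimpleGraph.Walk.support_cons]
    exact List.mem_map.2 ⟨y, by simp, rfl⟩

/-- The Helly property of subtrees, by removal of leaves. If some `x ∈ K` misses the bag of the leaf
`w`, every member of `K` in that bag meets `x` at another node, hence lies in the bag of the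
neighbour `p` as well. So `p` can replace `w`. -/
theorem exists_subset_bag [DecidableEq W] (hA : (D.tree.induce (A : Set W)).Connected) {K : Finset V}
    (hK : ∀ u ∈ K, ∀ v ∈ K, ∃ z ∈ A, u ∈ D.bag z ∧ v ∈ D.bag z) : ∃ z ∈ A, K ⊆ D.bag z := by
  induction hn : A.card using Nat.strong_induction_on generalizing A with
  | _ n ih =>
  by_cases hcard : 2 ≤ A.card
  · obtain ⟨w, hw, hleaf⟩ := D.isTree.exists_leaf_induce hA hcard
    by_cases hKw : K ⊆ D.bag w
    · exact ⟨w, hw, hKw⟩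
    obtain ⟨x, hxK, hxw⟩ := Finset.not_subset.1 hKw
    obtain ⟨p, ⟨hp, hadj⟩, huniq⟩ := id hleaf
    have key : ∀ u ∈ K, u ∈ D.bag w → u ∈ D.bag p := fun u hu huw => by
      obtain ⟨z, hz, huz, hxz⟩ := hK u hu x hxK
      obtain ⟨q, hq, hwq, huq⟩ := D.exists_adj_mem_bag hA hw hz
        (by rintro rfl; exact hxw hxz) huw huz
      rwa [← huniq q ⟨hq, hwq⟩]
    obtain ⟨z, hz, hKz⟩ := ih (A.erase w).card (hn ▸ Finset.card_erase_lt_of_mem hw)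
      (hA.induce_erase_leaf hw hleaf) (fun u hu v hv => by
        obtain ⟨z, hz, huz, hvz⟩ := hK u hu v hv
        by_cases hzw : z = w
        · subst hzw
          exact ⟨p, Finset.mem_erase.2 ⟨hadj.ne', hp⟩, key u hu huz, key v hv hvz⟩
        · exact ⟨z, Finset.mem_erase.2 ⟨hzw, hz⟩, huz, hvz⟩) rfl
    exact ⟨z, Finset.mem_of_mem_erase hz, hKz⟩
  · obtain ⟨⟨w, hw⟩⟩ := hA.nonempty
    have hone : ∀ z ∈ A, z = w := fun z hz => by
      have : A.card ≤ 1 := by omega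
      exact Finset.card_le_one.1 this z hz w hw
    refine ⟨w, hw, fun u hu => ?_⟩
    obtain ⟨z, hz, huz, -⟩ := hK u hu u hu
    rwa [← hone z hz]

theorem connected_univ [Fintype W] :
    (D.tree.induce ((Finset.univ : Finset W) : Set W)).Connected := by
  rw [Finset.coe_univ]
  exact (SimpleGraph.induceUnivIso D.tree).connected_iff.2 D.isTree.connected

theorem exists_isNClique_subset_bag [Fintype W] [DecidableEq W] {h : ℕ} {K : Finset V} (hK : G.IsNClique h K) :
    ∃ z, K ⊆ D.bag z := by
  obtain ⟨z, -, hz⟩ := D.exists_subset_bag D.connected_univ (K := K) fun u hu v hv => by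
    by_cases huv : u = v
    · subst huv
      obtain ⟨z, hz⟩ := D.exists_mem_bag u
      exact ⟨z, Finset.mem_univ _, hz, hz⟩
    · obtain ⟨z, hz⟩ := D.exists_edge_bag u v (hK.1 hu hv huv)
      exact ⟨z, Finset.mem_univ _, hz⟩
  exact ⟨z, hz⟩

/-- The sets `S ⊆ bag w` and `S' ⊆ bag p` agree on the intersection of the bags. -/
def Compat (w p : W) (S S' : Finset V) : Prop :=
  ∀ v ∈ D.bag w, v ∈ D.bag p → (v ∈ S ↔ v ∈ S')

variable {D} in
theorem Compat.symm {w p : W} {S S' : Finset V} (h : D.Compat w p S S') : D.Compat p w S' S :=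
  fun v hp hw => (h v hw hp).symm

/-- An assignment of codes of subsets of the bags to the nodes, where `dec w s` is the subset of the
bag of `w` with code `s`, that is consistent on the nodes in `A`. -/
def Consistent (Q : ℕ) (dec : W → ℕ → Finset V) (A : Finset W) (σ : W → ℕ) : Prop :=
  (∀ w, σ w < Q) ∧ ∀ w ∈ A, ∀ p ∈ A, D.tree.Adj w p → D.Compat w p (dec w (σ w)) (dec p (σ p))

/-- The minimum cost of a consistent assignment is `k`, and `A` is the set of the remaining nodes
of the tree in a successive elimination of leaves. -/
structure IsTable (Q : ℕ) (dec : W → ℕ → Finset V) (k : ℕ) (A : Finset W) (f : W → ℕ → ℕ) :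
    Prop where
  connected : (D.tree.induce (A : Set W)).Connected
  le_sum : ∀ σ, D.Consistent Q dec A σ → k ≤ ∑ w ∈ A, f w (σ w)
  exists_le : ∃ σ, D.Consistent Q dec A σ ∧ ∑ w ∈ A, f w (σ w) ≤ k

variable {Q k : ℕ} {dec : W → ℕ → Finset V} {f : W → ℕ → ℕ}

variable {D} in
-- Here `msg s` is the minimum of `f w s'` over all `s'` compatible with `s`. As `p` is the only
-- remaining neighbour of `w`, the choice at `w` is constrained by the one at `p` alone and can be
-- optimized separately.
theorem IsTable.erase [DecidableEq W] (hf : D.IsTable Q dec k A f) {w p : W} (hw : w ∈ A)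
    (hp : p ∈ A) (hwp : D.tree.Adj w p) (huniq : ∀ q ∈ A, D.tree.Adj w q → q = p)
    {f' : W → ℕ → ℕ} {msg : ℕ → ℕ} (hf' : ∀ u ∈ A, u ≠ w → u ≠ p → ∀ s < Q, f' u s = f u s)
    (hfp : ∀ s < Q, f' p s = f p s + msg s)
    (hmsg : ∀ s < Q, ∀ s' < Q, D.Compat w p (dec w s') (dec p s) → msg s ≤ f w s')
    (hmsg' : ∀ s < Q, ∃ s' < Q, D.Compat w p (dec w s') (dec p s) ∧ msg s = f w s') :
    D.IsTable Q dec k (A.erase w) f' := by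
  have hsum : ∀ σ : W → ℕ, (∀ w, σ w < Q) →
      ∑ u ∈ A.erase w, f' u (σ u) = ∑ u ∈ A.erase w, f u (σ u) + msg (σ p) := by
    intro σ hσ
    have hp' : p ∈ A.erase w := Finset.mem_erase.2 ⟨hwp.ne', hp⟩
    rw [← Finset.add_sum_erase _ _ hp', ← Finset.add_sum_erase _ (fun u => f u (σ u)) hp',
      hfp _ (hσ p), Finset.sum_congr rfl fun u hu => ?_]
    · ring
    · simp only [Finset.mem_erase] at hu
      exact hf' u hu.2.2 hu.2.1 hu.1 _ (hσ u)
  refine ⟨hf.connected.induce_erase_leaf hw ⟨p, ⟨hp, hwp⟩, fun q hq => huniq q hq.1 hq.2⟩,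
    fun σ hσ => ?_, ?_⟩
  · rw [hsum σ hσ.1]
    obtain ⟨s', hs', hcompat, heq⟩ := hmsg' (σ p) (hσ.1 p)
    rw [heq]
    -- Extend `σ` to `w` by an optimal compatible choice.
    have := hf.le_sum (Function.update σ w s') ⟨fun u => ?_, fun u hu q hq huq => ?_⟩
    · rw [← Finset.sum_erase_add _ _ hw, Function.update_self] at this
      refine this.trans_eq ?_
      congr 1
      refine Finset.sum_congr rfl fun u hu => ?_
      rw [Function.update_of_ne (Finset.ne_of_mem_erase hu)]
    · by_cases h : u = w
      · subst h; simpa using hs'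
      · simpa [h] using hσ.1 u
    · by_cases h : u = w
      · subst h
        obtain rfl := huniq q hq huq
        simpa [huq.ne'] using hcompat
      · by_cases h' : q = w
        · subst h'
          obtain rfl := huniq u hu huq.symm
          simpa [h] using hcompat.symm
        · simpa [h, h'] using hσ.2 u (Finset.mem_erase.2 ⟨h, hu⟩) q
            (Finset.mem_erase.2 ⟨h', hq⟩) huq
  -- An optimal assignment on `A` stays consistent on fewer nodes, and its entry at `w` is a
  -- candidate for the message.
  · obtain ⟨σ, hσ, hle⟩ := hf.exists_le
    refine ⟨σ, ⟨hσ.1, fun u hu q hq => hσ.2 u (Finset.mem_of_mem_erase hu) q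
      (Finset.mem_of_mem_erase hq)⟩, ?_⟩
    rw [hsum σ hσ.1]
    refine le_trans ?_ hle
    rw [← Finset.sum_erase_add _ _ hw]
    exact Nat.add_le_add_left (hmsg _ (hσ.1 p) _ (hσ.1 w) (hσ.2 w hw p hp hwp)) _

variable {D} in
theorem IsTable.isLeast {w : W} (hf : D.IsTable Q dec k {w} f) :
    IsLeast {j | ∃ s < Q, f w s = j} k := by
  have hlow : ∀ s < Q, k ≤ f w s := fun s hs => by
    simpa using hf.le_sum (fun _ => s) ⟨fun _ => hs, fun u hu p hp hup => by
      rw [Finset.mem_singleton] at hu hp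
      exact absurd (hu.trans hp.symm) hup.ne⟩
  obtain ⟨σ, hσ, hle⟩ := hf.exists_le
  refine ⟨⟨σ w, hσ.1 w, le_antisymm (by simpa using hle) (hlow _ (hσ.1 w))⟩, ?_⟩
  rintro _ ⟨s, hs, rfl⟩
  exact hlow s hs

end TreeDecomposition

/-! ## Hitting sets -/

/-- `X` hits all cliques on `h` vertices. -/
def HitsCliques {V : Type*} (h : ℕ) (G : SimpleGraph V) (X : Finset V) : Prop :=
  ∀ K : Finset V, G.IsNClique h K → ¬ Disjoint K X

theorem exists_isLeast_hitsCliques {V : Type*} [Fintype V] {h : ℕ} (hh : 1 ≤ h)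
    (G : SimpleGraph V) :
    ∃ k, IsLeast {j | ∃ X, HitsCliques h G X ∧ X.card = j} k := by
  classical
  have : ∃ j, j ∈ {j | ∃ X, HitsCliques h G X ∧ X.card = j} := by
    refine ⟨_, Finset.univ, fun K hK hdisj => ?_, rfl⟩
    obtain rfl := Finset.eq_empty_of_forall_notMem fun x hx =>
      Finset.disjoint_left.1 hdisj hx (Finset.mem_univ x)
    have := hK.2
    simp at this
    omega
  exact ⟨Nat.find this, Nat.find_spec this, fun j hj => Nat.find_min' this hj⟩

section Hitting

variable {V : Type*} [Fintype V] [DecidableEq V] {G : SimpleGraph V} {h l : ℕ} {X : Finset V}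

theorem hitsAllCopies_cliquePlusIndep_iff :
    HitsAllCopies (cliquePlusIndep h l) G X ↔
      HitsCliques h G X ∨ Fintype.card V < X.card + (h + l) := by
  constructor
  · intro hX
    by_contra! hcon
    obtain ⟨hcl, hcard⟩ := hcon
    unfold HitsCliques at hcl
    push Not at hcl
    obtain ⟨K, hK, hdisj⟩ := hcl
    -- At least `h + l` vertices avoid `X`, and `K` uses up only `h` of them.
    have hl : l ≤ (X ∪ K)ᶜ.card := by
      rw [Finset.card_compl, Finset.card_union_of_disjoint hdisj.symm, hK.2]
      omega
    obtain ⟨L, hL, hLcard⟩ := Finset.exists_subset_card_eq hl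
    let eK := (K.equivFinOfCardEq hK.2).symm
    let eL := (L.equivFinOfCardEq hLcard).symm
    have hL' : ∀ x : L, (x : V) ∉ X ∧ (x : V) ∉ K := fun x => by
      simpa using hL x.2
    let φ : cliquePlusIndep h l →g G :=
      { toFun := Sum.elim (fun i => (eK i : V)) (fun i => (eL i : V))
        map_rel' := by
          rintro (a | a) (b | b) hab
          · have hab' : a ≠ b := by simpa [cliquePlusIndep] using hab
            exact hK.1 (eK a).2 (eK b).2 fun h => hab' (eK.injective (Subtype.ext h))
          all_goals simp [cliquePlusIndep] at hab }
    obtain ⟨u, hu⟩ := hX φ (by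
      rintro (a | a) (b | b) hab
      · exact congrArg _ (eK.injective (Subtype.ext hab))
      · exact absurd ((show (eK a : V) = eL b from hab) ▸ (eK a).2) (hL' (eL b)).2
      · exact absurd ((show (eL a : V) = eK b from hab) ▸ (eK b).2) (hL' (eL a)).2
      · exact congrArg _ (eL.injective (Subtype.ext hab)))
    rcases u with a | a
    · exact Finset.disjoint_left.1 hdisj (eK a).2 hu
    · exact (hL' (eL a)).1 hu
  · rintro (hX | hX) f hf
    · by_contra! hcon
      refine hX (Finset.univ.map ⟨fun i : Fin h => f (Sum.inl i),
        fun a b hab => Sum.inl_injective (hf hab)⟩) ⟨?_, by simp⟩ ?_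
      · intro x hx y hy hxy
        simp only [Finset.coe_map, Finset.coe_univ, Set.image_univ,
          Set.mem_range] at hx hy
        obtain ⟨a, rfl⟩ := hx
        obtain ⟨b, rfl⟩ := hy
        refine f.map_rel ?_
        have : a ≠ b := by rintro rfl; exact hxy rfl
        simpa [cliquePlusIndep] using this
      · rw [Finset.disjoint_left]
        rintro _ hx
        obtain ⟨a, -, rfl⟩ := Finset.mem_map.1 hx
        exact hcon _
    · by_contra! hcon
      have : (Finset.univ.map ⟨f, hf⟩).card ≤ Xᶜ.card := Finset.card_le_card fun x hx => by
        obtain ⟨a, -, rfl⟩ := Finset.mem_map.1 hx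
        simpa using hcon a
      have hX' := Finset.card_le_univ X
      simp only [Finset.card_map, Finset.card_univ, Fintype.card_sum, Fintype.card_fin,
        Finset.card_compl] at this
      omega

theorem isMinHittingSize_cliquePlusIndep (hh : 1 ≤ h) {k : ℕ}
    (hk : IsLeast {j | ∃ X, HitsCliques h G X ∧ X.card = j} k) :
    IsMinHittingSize (cliquePlusIndep h l) G (min (Fintype.card V - (h + l - 1)) k) := by
  constructor
  · rcases le_total k (Fintype.card V - (h + l - 1)) with hle | hle
    · obtain ⟨X, hX, hc⟩ := hk.1
      rw [min_eq_right hle]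
      exact ⟨X, hitsAllCopies_cliquePlusIndep_iff.2 (.inl hX), hc⟩
    · rw [min_eq_left hle]
      -- Any set that leaves at most `h + l - 1` vertices will do. For fewer than `h + l` vertices
      -- the truncated difference is `0`, and the empty set works.
      obtain ⟨X, -, hX⟩ := Finset.exists_subset_card_eq (s := (Finset.univ : Finset V))
        (n := Fintype.card V - (h + l - 1)) (by rw [Finset.card_univ]; omega)
      exact ⟨X, hitsAllCopies_cliquePlusIndep_iff.2 (.inr (by omega)), hX⟩
  · rintro _ ⟨X, hX, rfl⟩
    rcases hitsAllCopies_cliquePlusIndep_iff.1 hX with hX | hX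
    · exact (min_le_right _ _).trans (hk.2 ⟨X, hX, rfl⟩)
    · exact (min_le_left _ _).trans (by omega)

open Classical in
/-- The initial table: the number of vertices in `S` for which `w` is the first node, and a penalty
if there is a clique in the bag that avoids `S`. -/
noncomputable def TreeDecomposition.weight {m : ℕ} (D : TreeDecomposition G (Fin m)) (h : ℕ)
    (w : Fin m) (S : Finset V) : ℕ :=
  {v ∈ S | ∀ u < w, v ∉ D.bag u}.card +
    if ∃ K, G.IsNClique h K ∧ K ⊆ D.bag w ∧ Disjoint K S then Fintype.card V + 1 else 0

theorem TreeDecomposition.isTable_weight {m : ℕ} (D : TreeDecomposition G (Fin m)) {Q k : ℕ}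
    {dec : Fin m → ℕ → Finset V} (hdec : ∀ w s, dec w s ⊆ D.bag w)
    (hsurj : ∀ w, ∀ S ⊆ D.bag w, ∃ s < Q, dec w s = S)
    (hk : IsLeast {j | ∃ X, HitsCliques h G X ∧ X.card = j} k) :
    D.IsTable Q dec k Finset.univ fun w s => D.weight h w (dec w s) := by
  classical
  -- every vertex has a first node
  have hfirst : ∀ v, ∃ w, v ∈ D.bag w ∧ ∀ u < w, v ∉ D.bag u := fun v => by
    have hne : {w | v ∈ D.bag w}.Nonempty := D.exists_mem_bag v
    exact ⟨wellFounded_lt.min _ hne, wellFounded_lt.min_mem _ hne,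
      fun u hu hv => wellFounded_lt.not_lt_min {w | v ∈ D.bag w} hv hu⟩
  have hkn : k ≤ Fintype.card V := by
    obtain ⟨X, -, rfl⟩ := hk.1
    exact Finset.card_le_univ X
  refine ⟨D.connected_univ, fun σ hσ => ?_, ?_⟩
  · by_cases hcl : ∃ w, ∃ K, G.IsNClique h K ∧ K ⊆ D.bag w ∧ Disjoint K (dec w (σ w))
    · obtain ⟨w, hw⟩ := hcl
      -- The penalty alone exceeds `k`, which is at most the number of vertices.
      refine le_trans ?_ (Finset.single_le_sum (fun _ _ => Nat.zero_le _) (Finset.mem_univ w))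
      rw [weight, if_pos hw]
      omega
    -- Otherwise the chosen sets glue together: membership spreads along tree paths by consistency,
    -- so their union `X` meets each bag exactly in the chosen set. It therefore hits all cliques,
    -- and each of its vertices is counted at its first node.
    · have htrans : ∀ {w z : Fin m} (p : D.tree.Walk w z) (v : V),
          (∀ x ∈ p.support, v ∈ D.bag x) → v ∈ dec w (σ w) → v ∈ dec z (σ z) := by
        intro w z p v
        induction p with
        | nil => exact fun _ h => h
        | cons hadj p ih =>
          intro hp hv
          refine ih (fun x hx => hp x (by simp [hx])) ?_
          exact (hσ.2 _ (Finset.mem_univ _) _ (Finset.mem_univ _) hadj v (hp _ (by simp))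
            (hp _ (by simp))).1 hv
      let X := Finset.univ.biUnion fun w => dec w (σ w)
      have hX : ∀ w v, v ∈ X → v ∈ D.bag w → v ∈ dec w (σ w) := fun w v hv hvw => by
        obtain ⟨z, -, hz⟩ := Finset.mem_biUnion.1 hv
        obtain ⟨p, hp⟩ := D.isTree.connected.exists_isPath z w
        exact htrans p v (fun x hx => D.mem_bag_of_path _ _ _ p hp hx v (hdec _ _ hz) hvw) hz
      have hhit : HitsCliques h G X := fun K hK hdisj => by
        obtain ⟨z, hz⟩ := D.exists_isNClique_subset_bag hK
        refine hcl ⟨z, K, hK, hz, hdisj.mono_right ?_⟩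
        exact Finset.subset_biUnion_of_mem (fun w => dec w (σ w)) (Finset.mem_univ z)
      refine (hk.2 ⟨X, hhit, rfl⟩).trans ?_
      have : X ⊆ Finset.univ.biUnion fun w => {v ∈ dec w (σ w) | ∀ u < w, v ∉ D.bag u} :=
        fun v hv => by
          obtain ⟨w, hw, hmin⟩ := hfirst v
          exact Finset.mem_biUnion.2 ⟨w, Finset.mem_univ _,
            Finset.mem_filter.2 ⟨hX w v hv hw, hmin⟩⟩
      refine (Finset.card_le_card this).trans (Finset.card_biUnion_le.trans ?_)
      exact Finset.sum_le_sum fun w _ => Nat.le_add_right _ _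
  -- The traces of an optimal `X` on the bags are consistent and incur no penalty. No vertex is
  -- counted at two nodes.
  · obtain ⟨X, hX, rfl⟩ := hk.1
    choose σ hσ hdecσ using fun w => hsurj w (X ∩ D.bag w) Finset.inter_subset_right
    refine ⟨σ, ⟨hσ, fun w _ p _ _ v hvw hvp => ?_⟩, ?_⟩
    · simp [hdecσ, hvw, hvp]
    · have h0 : ∀ w, D.weight h w (dec w (σ w)) =
          {v ∈ X ∩ D.bag w | ∀ u < w, v ∉ D.bag u}.card := fun w => by
        rw [weight, hdecσ, if_neg, add_zero]
        rintro ⟨K, hK, hKw, hdisj⟩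
        refine hX K hK (Finset.disjoint_left.2 fun v hv hvX => ?_)
        exact Finset.disjoint_left.1 hdisj hv (Finset.mem_inter.2 ⟨hvX, hKw hv⟩)
      rw [Finset.sum_congr rfl fun w _ => h0 w, ← Finset.card_biUnion]
      · refine Finset.card_le_card fun v hv => ?_
        obtain ⟨w, -, hw⟩ := Finset.mem_biUnion.1 hv
        exact (Finset.mem_inter.1 (Finset.mem_filter.1 hw).1).1
      · intro w _ z _ hwz
        refine Finset.disjoint_left.2 fun v hv hv' => ?_
        simp only [Finset.mem_filter, Finset.mem_inter] at hv hv'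
        rcases lt_or_gt_of_ne hwz with hlt | hlt
        · exact hv'.2 w hlt hv.1.2
        · exact hv.2 z hlt hv'.1.2

end Hitting

/-! ## The input -/

theorem List.getElem?_flatMap_of_length {α β : Type*} {b : ℕ} (f : α → List β) (L : List α)
    (hf : ∀ a ∈ L, (f a).length = b) (i j : ℕ) (hj : j < b) :
    (L.flatMap f)[i * b + j]? = L[i]?.bind fun a => (f a)[j]? := by
  induction L generalizing i with
  | nil => simp
  | cons a L ih =>
    have ha := hf a (by simp)
    rw [List.flatMap_cons]
    cases i with
    | zero => rw [List.getElem?_append_left (by omega)]; simp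
    | succ i =>
      have h : (i + 1) * b + j - (f a).length = i * b + j := by
        rw [ha, Nat.succ_mul]; omega
      rw [List.getElem?_append_right (by rw [ha, Nat.succ_mul]; omega), h,
        ih (fun a ha => hf a (by simp [ha]))]
      simp

theorem length_encodeRel {a b : ℕ} (R : Fin a → Fin b → Prop) :
    (encodeRel R).length = a * b := by
  simp [encodeRel, List.length_flatMap]

open Classical in
theorem getElem?_encodeRel {a b : ℕ} (R : Fin a → Fin b → Prop) (i : Fin a) (j : Fin b) :
    (encodeRel R)[(i : ℕ) * b + j]? = some (if R i j then 1 else 0) := by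
  rw [encodeRel, List.getElem?_flatMap_of_length (b := b) _ _ (by simp) _ _ j.2]
  simp

theorem Nat.mul_add_lt_mul {a b i j : ℕ} (hi : i < a) (hj : j < b) : i * b + j < a * b :=
  calc i * b + j < (i + 1) * b := by rw [Nat.succ_mul]; omega
    _ ≤ a * b := Nat.mul_le_mul_right _ hi

section Input

variable {n m : ℕ} {G : SimpleGraph (Fin n)} (D : TreeDecomposition G (Fin m))

theorem length_encodeInput : (encodeInput G D).length = 2 + n * n + m * m + m * n := by
  simp only [encodeInput, List.length_cons, List.length_append, length_encodeRel]
  omega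

/-- The memory `M` contains the input. -/
def ContainsInput (M : ℕ → ℕ) : Prop :=
  ∀ i < (encodeInput G D).length, M i = (encodeInput G D).getD i 0

variable {D} {M : ℕ → ℕ}

namespace ContainsInput

theorem zero (hM : ContainsInput D M) : M 0 = n := by
  rw [hM 0 (by rw [length_encodeInput]; omega)]
  rfl

theorem one (hM : ContainsInput D M) : M 1 = m := by
  rw [hM 1 (by rw [length_encodeInput]; omega)]
  rfl

open Classical in
theorem adj (hM : ContainsInput D M) (u v : Fin n) :
    M (2 + u * n + v) = if G.Adj u v then 1 else 0 := by
  have hlt := Nat.mul_add_lt_mul u.2 v.2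
  rw [hM _ (by rw [length_encodeInput]; omega),
    show 2 + (u : ℕ) * n + v = (u * n + v) + 1 + 1 by omega, encodeInput, List.getD_cons_succ,
    List.getD_cons_succ, List.getD_eq_getElem?_getD, List.append_assoc,
    List.getElem?_append_left (by rwa [length_encodeRel]), getElem?_encodeRel, Option.getD_some]

open Classical in
theorem tree (hM : ContainsInput D M) (w p : Fin m) :
    M (2 + n * n + w * m + p) = if D.tree.Adj w p then 1 else 0 := by
  have hlt := Nat.mul_add_lt_mul w.2 p.2
  rw [hM _ (by rw [length_encodeInput]; omega),
    show 2 + n * n + (w : ℕ) * m + p = n * n + (w * m + p) + 1 + 1 by omega, encodeInput,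
    List.getD_cons_succ, List.getD_cons_succ, List.getD_eq_getElem?_getD,
    List.getElem?_append_left
      (by simp only [List.length_append, length_encodeRel]; omega),
    List.getElem?_append_right (by rw [length_encodeRel]; omega), length_encodeRel,
    Nat.add_sub_cancel_left, getElem?_encodeRel, Option.getD_some]

theorem bag (hM : ContainsInput D M) (w : Fin m) (v : Fin n) :
    M (2 + n * n + m * m + w * n + v) = if v ∈ D.bag w then 1 else 0 := by
  classical
  have hlt := Nat.mul_add_lt_mul w.2 v.2
  rw [hM _ (by rw [length_encodeInput]; omega),
    show 2 + n * n + m * m + (w : ℕ) * n + v = n * n + m * m + (w * n + v) + 1 + 1 by omega,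
    encodeInput, List.getD_cons_succ, List.getD_cons_succ, List.getD_eq_getElem?_getD,
    List.getElem?_append_right
      (by simp only [List.length_append, length_encodeRel]; omega),
    List.length_append, length_encodeRel, length_encodeRel,
    Nat.add_sub_cancel_left, getElem?_encodeRel, Option.getD_some]
  congr

end ContainsInput

end Input

/-! ## Codes of subsets of the bags -/

/-- This tests a bit by a remainder and a comparison, both of which are available through repeated
subtraction. -/
theorem Nat.two_pow_le_mod_two_pow_succ_iff (s r : ℕ) :
    2 ^ r ≤ s % 2 ^ (r + 1) ↔ s.testBit r = true := by
  rw [Nat.mod_pow_succ, Nat.testBit_eq_decide_div_mod_eq, decide_eq_true_eq]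
  have h1 := Nat.mod_lt s (Nat.two_pow_pos r)
  rcases Nat.mod_two_eq_zero_or_one (s / 2 ^ r) with h | h <;> rw [h] <;> omega

namespace TreeDecomposition

variable {n m : ℕ} {G : SimpleGraph (Fin n)} (D : TreeDecomposition G (Fin m))

/-- The number of elements of the bag of `w` that are less than `v`. -/
def rank (w : Fin m) (v : ℕ) : ℕ :=
  Nat.count (· ∈ (D.bag w).map Fin.valEmbedding) v

/-- The subset of the bag of `w` with code `s`. -/
def decode (w : Fin m) (s : ℕ) : Finset (Fin n) :=
  {v ∈ D.bag w | s.testBit (D.rank w v) = true}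

theorem decode_subset (w : Fin m) (s : ℕ) : D.decode w s ⊆ D.bag w :=
  Finset.filter_subset _ _

theorem rank_eq_card (w : Fin m) : D.rank w n = (D.bag w).card := by
  rw [rank, Nat.count_eq_card_filter_range, ← Finset.card_map Fin.valEmbedding]
  congr 1
  ext u
  simp only [Finset.mem_filter, Finset.mem_range, Finset.mem_map, Fin.valEmbedding_apply,
    and_iff_right_iff_imp]
  rintro ⟨v, -, rfl⟩
  exact v.2

/-- `rank` is injective on the bag with values below its size, so the ranks of the members of `S`
can serve as the bits of a code. -/
theorem exists_decode_eq {w : Fin m} {S : Finset (Fin n)} (hS : S ⊆ D.bag w) :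
    ∃ s < 2 ^ (D.bag w).card, D.decode w s = S := by
  have hmem : ∀ v ∈ D.bag w, (v : ℕ) ∈ (D.bag w).map Fin.valEmbedding := fun v hv =>
    Finset.mem_map_of_mem _ hv
  refine ⟨Nat.ofBits fun i : Fin (D.bag w).card => decide (∃ v ∈ S, D.rank w v = i),
    Nat.ofBits_lt_two_pow _, ?_⟩
  ext v
  rw [decode, Finset.mem_filter]
  refine ⟨fun ⟨hv, hbit⟩ => ?_, fun hv => ⟨hS hv, ?_⟩⟩
  · have hlt : D.rank w v < (D.bag w).card :=
      (Nat.count_strict_mono (hmem v hv) v.2).trans_eq (D.rank_eq_card w)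
    rw [Nat.testBit_ofBits_lt _ _ hlt, decide_eq_true_eq] at hbit
    obtain ⟨u, hu, huv⟩ := hbit
    rwa [← Fin.ext (Nat.count_injective (hmem u (hS hu)) (hmem v hv) huv)]
  · have hlt : D.rank w v < (D.bag w).card :=
      (Nat.count_strict_mono (hmem v (hS hv)) v.2).trans_eq (D.rank_eq_card w)
    rw [Nat.testBit_ofBits_lt _ _ hlt, decide_eq_true_eq]
    exact ⟨v, hv, rfl⟩

/-- A bound for the codes. -/
def codeBound : ℕ := Finset.univ.sup fun w => 2 ^ (D.bag w).card

/-- One bound serves all nodes; at smaller bags the surplus codes merely repeat subsets. -/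
theorem exists_lt_codeBound_decode_eq (w : Fin m) (S : Finset (Fin n)) (hS : S ⊆ D.bag w) :
    ∃ s < D.codeBound, D.decode w s = S := by
  obtain ⟨s, hs, h⟩ := D.exists_decode_eq hS
  exact ⟨s, hs.trans_le (Finset.le_sup (f := fun w => 2 ^ (D.bag w).card) (Finset.mem_univ w)), h⟩

theorem codeBound_le : D.codeBound ≤ 2 ^ (D.width + 1) := by
  refine Finset.sup_le fun w _ => Nat.pow_le_pow_right (by norm_num) ?_
  have := Finset.le_sup (f := fun w => (D.bag w).card) (Finset.mem_univ w)
  rw [width]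
  omega

end TreeDecomposition

/-! ## Values of loops -/

namespace RAM

theorem iter_add (g : ℕ → ℕ) (b a : ℕ) :
    iter b (fun i a => a + g i) a = a + ∑ i ∈ Finset.range b, g i := by
  induction b with
  | zero => simp
  | succ b ih => rw [iter_succ, ih, Finset.sum_range_succ, add_assoc]

theorem iter_dbl (p : ℕ → Prop) [DecidablePred p] {g : ℕ → ℕ} {b : ℕ}
    (hg : ∀ i < b, g i = if p i then 1 else 0) (a : ℕ) :
    iter b (fun i a => if g i = 0 then a else a + a) a = a * 2 ^ Nat.count p b := by
  induction b with
  | zero => simp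
  | succ b ih =>
    rw [iter_succ, ih fun i hi => hg i (by omega), Nat.count_succ, hg b (by omega)]
    by_cases h : p b <;> simp [h]
    ring

/-- Every effective subtraction lowers the value by at least one, so `b ≥ s` rounds suffice to get
below `e`. -/
theorem iter_csub {e s b : ℕ} (he : 0 < e) (hs : s ≤ b) :
    iter b (fun _ a => if e ≤ a then a - e else a) s = s % e := by
  have h := iter_induction (n := b) (f := fun _ a => if e ≤ a then a - e else a) (a := s)
    (fun i a => a % e = s % e ∧ (a < e ∨ a + i ≤ s)) ⟨rfl, .inr le_rfl⟩ (by
      rintro i - a ⟨h1, h2⟩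
      by_cases h : e ≤ a
      · rw [if_pos h, ← Nat.mod_eq_sub_mod h]
        exact ⟨h1, by omega⟩
      · rw [if_neg h]
        exact ⟨h1, by omega⟩)
  rw [← h.1, Nat.mod_eq_of_lt]
  omega

theorem iter_max (g : ℕ → ℕ) (b : ℕ) :
    iter b (fun i a => max a (g i)) 0 = (Finset.range b).sup g := by
  induction b with
  | zero => simp
  | succ b ih => rw [iter_succ, ih, Finset.range_add_one, Finset.sup_insert]; exact max_comm _ _

theorem iter_min_le_init (g : ℕ → ℕ) (b a : ℕ) : iter b (fun i a => min a (g i)) a ≤ a := by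
  induction b with
  | zero => simp
  | succ b ih => exact (min_le_left _ _).trans ih

theorem iter_min_le (g : ℕ → ℕ) {b i : ℕ} (a : ℕ) (hi : i < b) :
    iter b (fun i a => min a (g i)) a ≤ g i := by
  induction b with
  | zero => omega
  | succ b ih =>
    rcases Nat.lt_succ_iff_lt_or_eq.1 hi with h | rfl
    · exact (min_le_left _ _).trans (ih h)
    · exact min_le_right _ _

theorem iter_min_eq (g : ℕ → ℕ) (b a : ℕ) : iter b (fun i a => min a (g i)) a = a ∨
    ∃ i < b, iter b (fun i a => min a (g i)) a = g i := by
  induction b with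
  | zero => simp
  | succ b ih =>
    rw [iter_succ]
    rcases min_choice (iter b (fun i a => min a (g i)) a) (g b) with h | h
    · rcases ih with h' | ⟨i, hi, h'⟩
      · exact .inl (h.trans h')
      · exact .inr ⟨i, by omega, h.trans h'⟩
    · exact .inr ⟨b, by omega, h⟩

end RAM

/-! ## The expressions of the algorithm

The variables `0, 1, 2, 3` hold the size of the input, the numbers of vertices and nodes, and the
bound for the codes. The memory behind the input holds, for every node, a bit that tells if the node
remains, and the rows of the table. -/

namespace RAM.Expr

def zero : Expr := const 0

def one : Expr := const 1

def plus (e₁ e₂ : Expr) : Expr := bin .add e₁ e₂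

/-- `1` if `e₁ ≤ e₂` and `0` otherwise -/
def le (e₁ e₂ : Expr) : Expr := bin .sub one (bin .sub e₁ e₂)

/-- nonzero if and only if `e₁ ≠ e₂` -/
def ne (e₁ e₂ : Expr) : Expr := plus (bin .sub e₁ e₂) (bin .sub e₂ e₁)

/-- The sum of the values of `e` for `x < b`. -/
def sum (x b : ℕ) (e : Expr) : Expr := fold .add x b zero e

/-- Repeated addition, since the machine cannot multiply. The counter `13` is used nowhere else. -/
def mul (x y : ℕ) : Expr := sum 13 x (var y)

def adj (u v : ℕ) : Expr := mem (plus (plus (const 2) (mul u 1)) (var v))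

def tree (w p : ℕ) : Expr :=
  mem (plus (plus (plus (const 2) (mul 1 1)) (mul w 2)) (var p))

def bag (w v : ℕ) : Expr :=
  mem (plus (plus (plus (plus (const 2) (mul 1 1)) (mul 2 2)) (mul w 1)) (var v))

def aliveAddr (w : ℕ) : Expr := plus (var 0) (var w)

def alive (w : ℕ) : Expr := mem (aliveAddr w)

def tableAddr (w s : ℕ) : Expr := plus (plus (var 0) (var 2)) (plus (mul w 3) (var s))

def table (w s : ℕ) : Expr := mem (tableAddr w s)

/-- `2 ^ rank w v` -/
def rankPow (w v : ℕ) : Expr := fold .dbl 12 v one (bag w 12)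

/-- Is `v` an element of the set with code `s`? -/
def elem (w s v : ℕ) : Expr :=
  ite (bag w v)
    (le (rankPow w v) (fold .csub 11 3 (var s) (plus (rankPow w v) (rankPow w v)))) zero

/-- nonzero if and only if the sets with codes `s` and `s'` do not agree on the intersection of the
bags of `w` and `p` -/
def incompat (w p s s' : ℕ) : Expr :=
  sum 8 1 (ite (bag w 8) (ite (bag p 8) (ne (elem w s 8) (elem p s' 8)) zero) zero)

def size (w q : ℕ) : Expr := sum 8 1 (elem w q 8)

def overlap (w q s : ℕ) : Expr := sum 8 1 (ite (elem w q 8) (elem w s 8) zero)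

def nonadj (w q : ℕ) : Expr :=
  sum 8 1 (sum 9 1 (ite (elem w q 8) (ite (elem w q 9)
    (ite (ne (var 8) (var 9)) (bin .sub one (adj 8 9)) zero) zero) zero))

/-- the number of `h`-cliques in the bag of `w` that avoid the set with code `s` -/
def cliques (h w s : ℕ) : Expr :=
  sum 14 3 (ite (ne (size w 14) (const h)) zero (ite (overlap w 14 s) zero
    (ite (nonadj w 14) zero one)))

def weight (h w s : ℕ) : Expr :=
  plus (sum 8 1 (ite (elem w s 8) (ite (sum 9 w (bag 9 8)) zero one) zero))
    (ite (cliques h w s) (plus (var 1) one) zero)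

/-- An upper bound for the entries of the row, used in place of infinity in `message`. -/
def rowSum (w : ℕ) : Expr := sum 10 3 (table w 10)

/-- the minimum entry of the row `w` that is compatible with `s` -/
def message (w p s : ℕ) : Expr :=
  fold .min 10 3 (rowSum w) (ite (incompat w p 10 s) (rowSum w) (table w 10))

def leaf (w : ℕ) : Expr :=
  ite (alive w) (ite (ne (sum 9 2 (ite (alive 9) (tree w 9) zero)) one) zero one) zero

def codeBound : Expr := fold .max 4 2 zero (fold .dbl 8 1 one (bag 4 8))

/-- the minimum of `n - c` and the sums of the entries of the remaining nodes for the same code -/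
def output (c : ℕ) : Expr :=
  fold .min 6 3 (bin .sub (var 1) (const c)) (sum 4 2 (ite (alive 4) (table 4 6) zero))

end RAM.Expr

/-! ### Values of the expressions -/

namespace RAM

section Eval

variable {n m : ℕ} {G : SimpleGraph (Fin n)} (D : TreeDecomposition G (Fin m))

/-- The values of the global variables. -/
structure IsEnv (ρ : ℕ → ℕ) : Prop where
  zero : ρ 0 = (encodeInput G D).length
  one : ρ 1 = n
  two : ρ 2 = m
  three : ρ 3 = D.codeBound

/-- The first variables have the right values. -/
structure IsPreEnv (n m : ℕ) (ρ : ℕ → ℕ) : Prop where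
  one : ρ 1 = n
  two : ρ 2 = m

variable {D} {M ρ : ℕ → ℕ}

theorem IsEnv.isPreEnv (hρ : IsEnv D ρ) : IsPreEnv n m ρ := ⟨hρ.one, hρ.two⟩

theorem IsEnv.update (hρ : IsEnv D ρ) {x : ℕ} (hx : 4 ≤ x) (i : ℕ) :
    IsEnv D (Function.update ρ x i) := by
  constructor <;> rw [Function.update_of_ne (by omega)]
  exacts [hρ.zero, hρ.one, hρ.two, hρ.three]

theorem IsPreEnv.update (hρ : IsPreEnv n m ρ) {x : ℕ} (hx : 4 ≤ x) (i : ℕ) :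
    IsPreEnv n m (Function.update ρ x i) := by
  constructor <;> rw [Function.update_of_ne (by omega)]
  exacts [hρ.one, hρ.two]

namespace Expr

@[simp] theorem eval_const (c : ℕ) : (const c).eval M ρ = c := rfl
@[simp] theorem eval_var (x : ℕ) : (var x).eval M ρ = ρ x := rfl
@[simp] theorem eval_mem (e : Expr) : e.mem.eval M ρ = M (e.eval M ρ) := rfl
@[simp] theorem eval_zero : zero.eval M ρ = 0 := rfl
@[simp] theorem eval_one : one.eval M ρ = 1 := rfl
@[simp] theorem eval_plus (e₁ e₂ : Expr) :
    (plus e₁ e₂).eval M ρ = e₁.eval M ρ + e₂.eval M ρ := rfl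
@[simp] theorem eval_sub (e₁ e₂ : Expr) :
    (bin .sub e₁ e₂).eval M ρ = e₁.eval M ρ - e₂.eval M ρ := rfl
@[simp] theorem eval_ite (e e₁ e₂ : Expr) :
    (ite e e₁ e₂).eval M ρ = if e.eval M ρ ≠ 0 then e₁.eval M ρ else e₂.eval M ρ := rfl

@[simp] theorem eval_le (e₁ e₂ : Expr) :
    (le e₁ e₂).eval M ρ = if e₁.eval M ρ ≤ e₂.eval M ρ then 1 else 0 := by
  simp only [le, eval_sub, eval_one]
  split_ifs <;> omega

theorem eval_ne_ne_zero (e₁ e₂ : Expr) :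
    (ne e₁ e₂).eval M ρ ≠ 0 ↔ e₁.eval M ρ ≠ e₂.eval M ρ := by
  simp only [ne, eval_plus, eval_sub]
  omega

theorem eval_sum (x b : ℕ) (e : Expr) : (sum x b e).eval M ρ =
    ∑ i ∈ Finset.range (ρ b), e.eval M (Function.update ρ x i) := by
  rw [sum, eval, eval_zero]
  exact (iter_add _ _ _).trans (Nat.zero_add _)

theorem eval_sum_fin {k : ℕ} (x b : ℕ) (e : Expr) (hb : ρ b = k) : (sum x b e).eval M ρ =
    ∑ i : Fin k, e.eval M (Function.update ρ x i) := by
  rw [eval_sum, hb, Finset.sum_range]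

@[simp] theorem eval_mul (x y : ℕ) (hy : y ≠ 13) : (mul x y).eval M ρ = ρ x * ρ y := by
  simp [mul, eval_sum, hy]

open Classical in
theorem eval_adj (hM : ContainsInput D M) (hρ : IsEnv D ρ) {x y : ℕ} {u v : Fin n}
    (hu : ρ x = u) (hv : ρ y = v) :
    (adj x y).eval M ρ = if G.Adj u v then 1 else 0 := by
  simp [adj, hρ.one, hu, hv, hM.adj]

open Classical in
theorem eval_tree (hM : ContainsInput D M) (hρ : IsEnv D ρ) {x y : ℕ} {w p : Fin m}
    (hw : ρ x = w) (hp : ρ y = p) :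
    (tree x y).eval M ρ = if D.tree.Adj w p then 1 else 0 := by
  simp [tree, hρ.one, hρ.two, hw, hp, hM.tree]

/-- `IsPreEnv` suffices, which matters because bags are read in computing the bound for the codes.
-/
theorem eval_bag (hM : ContainsInput D M) (hρ : IsPreEnv n m ρ) {x y : ℕ} {w : Fin m} {v : Fin n}
    (hw : ρ x = w) (hv : ρ y = v) :
    (bag x y).eval M ρ = if v ∈ D.bag w then 1 else 0 := by
  simp [bag, hρ.one, hρ.two, hw, hv, hM.bag]

theorem iter_dbl_bag (hM : ContainsInput D M) (hρ : IsPreEnv n m ρ) {x y : ℕ} (hy : 4 ≤ y)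
    (hxy : x ≠ y) {w : Fin m} {k : ℕ} (hw : ρ x = w) (hk : k ≤ n) :
    iter k (fun i a => Op.dbl.eval a ((bag x y).eval M (Function.update ρ y i))) 1 =
      2 ^ D.rank w k := by
  refine (iter_dbl (· ∈ (D.bag w).map Fin.valEmbedding) (fun i hi => ?_) 1).trans (one_mul _)
  rw [eval_bag hM (hρ.update hy i) (w := w) (v := ⟨i, by omega⟩) (by simp [hxy, hw]) (by simp)]
  have := Finset.mem_map' (a := (⟨i, by omega⟩ : Fin n)) (s := D.bag w) Fin.valEmbedding
  simp only [← this, Fin.valEmbedding_apply]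

theorem eval_rankPow (hM : ContainsInput D M) (hρ : IsEnv D ρ) {x y : ℕ} (hx : x ≠ 12)
    {w : Fin m} {v : Fin n} (hw : ρ x = w) (hv : ρ y = v) :
    (rankPow x y).eval M ρ = 2 ^ D.rank w v := by
  rw [rankPow, eval, eval_one, hv]
  exact iter_dbl_bag hM hρ.isPreEnv (by norm_num) hx hw v.2.le

/-- The remainder modulo `2 ^ (rank + 1)` takes at most `codeBound` subtractions because the code is
smaller than that. The conditions on `x` and `z` protect them from the inner counters `11` and `12`.
-/
theorem eval_elem (hM : ContainsInput D M) (hρ : IsEnv D ρ) {x y z : ℕ} (hx : x ≠ 11 ∧ x ≠ 12)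
    (hz : z ≠ 11) {w : Fin m} {v : Fin n} (hw : ρ x = w) (hv : ρ z = v)
    (hs : ρ y < D.codeBound) :
    (elem x y z).eval M ρ = if v ∈ D.decode w (ρ y) then 1 else 0 := by
  have hmod : (fold .csub 11 3 (var y) (plus (rankPow x z) (rankPow x z))).eval M ρ =
      ρ y % 2 ^ (D.rank w v + 1) := by
    rw [eval, hρ.three, eval_var, pow_succ, mul_two]
    rw [← iter_csub (b := D.codeBound) (by positivity) hs.le]
    refine iter_congr fun i _ a => ?_
    rw [eval_plus, eval_rankPow hM (hρ.update (by norm_num) i) hx.2 (w := w) (v := v)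
      (by simp [hx.1, hw]) (by simp [hz, hv])]
    rfl
  simp only [elem, eval_ite, eval_le, hmod, eval_bag hM hρ.isPreEnv hw hv,
    eval_rankPow hM hρ hx.2 hw hv, Nat.two_pow_le_mod_two_pow_succ_iff, TreeDecomposition.decode,
    Finset.mem_filter, eval_zero]
  by_cases h : v ∈ D.bag w <;> simp [h]

theorem eval_incompat (hM : ContainsInput D M) (hρ : IsEnv D ρ) {x x' y y' : ℕ}
    (hx : x ≠ 8 ∧ x ≠ 11 ∧ x ≠ 12) (hx' : x' ≠ 8 ∧ x' ≠ 11 ∧ x' ≠ 12) (hy : y ≠ 8) (hy' : y' ≠ 8)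
    {w p : Fin m} (hw : ρ x = w) (hp : ρ x' = p) (hs : ρ y < D.codeBound)
    (hs' : ρ y' < D.codeBound) :
    (incompat x x' y y').eval M ρ ≠ 0 ↔
      ¬ D.Compat w p (D.decode w (ρ y)) (D.decode p (ρ y')) := by
  rw [incompat, eval_sum_fin _ _ _ hρ.one, ← not_iff_not, not_not, not_not, Finset.sum_eq_zero_iff,
    TreeDecomposition.Compat]
  simp only [Finset.mem_univ, true_imp_iff]
  refine forall_congr' fun v => ?_
  have hρ' := hρ.update (x := 8) (by norm_num) v
  have h1 := eval_elem hM hρ' (x := x) (y := y) (z := 8) (w := w) (v := v) hx.2 (by norm_num)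
    (by simp [hx.1, hw]) (by simp) (by simpa [hy] using hs)
  have h2 := eval_elem hM hρ' (x := x') (y := y') (z := 8) (w := p) (v := v) hx'.2 (by norm_num)
    (by simp [hx'.1, hp]) (by simp) (by simpa [hy'] using hs')
  have h3 := eval_ne_ne_zero (M := M) (ρ := Function.update ρ 8 v) (elem x y 8) (elem x' y' 8)
  rw [h1, h2] at h3
  rw [eval_ite, eval_ite, eval_bag hM hρ'.isPreEnv (w := w) (v := v) (by simp [hx.1, hw])
    (by simp), eval_bag hM hρ'.isPreEnv (w := p) (v := v) (by simp [hx'.1, hp]) (by simp)]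
  simp only [Function.update_of_ne hy, Function.update_of_ne hy'] at h3
  by_cases hvw : v ∈ D.bag w
  · by_cases hvp : v ∈ D.bag p
    · simp only [hvw, hvp, if_true, ne_eq, one_ne_zero, not_false_eq_true, true_imp_iff]
      rw [← not_iff_not]
      refine h3.trans ?_
      by_cases ha : v ∈ D.decode w (ρ y) <;> by_cases hb : v ∈ D.decode p (ρ y') <;> simp [ha, hb]
    · simp [hvw, hvp]
  · simp [hvw]

theorem eval_size (hM : ContainsInput D M) (hρ : IsEnv D ρ) {x y : ℕ}
    (hx : x ≠ 8 ∧ x ≠ 11 ∧ x ≠ 12) (hy : y ≠ 8) {w : Fin m} (hw : ρ x = w)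
    (hs : ρ y < D.codeBound) : (size x y).eval M ρ = (D.decode w (ρ y)).card := by
  rw [size, eval_sum_fin _ _ _ hρ.one, Finset.sum_congr rfl fun (v : Fin n) _ => eval_elem hM
    (hρ.update (x := 8) (by norm_num) v) (x := x) (y := y) (z := 8) (w := w) (v := v) hx.2
    (by norm_num) (by simp [hx.1, hw]) (by simp) (by simpa [hy] using hs)]
  simp [hy]

theorem eval_overlap (hM : ContainsInput D M) (hρ : IsEnv D ρ) {x y y' : ℕ}
    (hx : x ≠ 8 ∧ x ≠ 11 ∧ x ≠ 12) (hy : y ≠ 8) (hy' : y' ≠ 8) {w : Fin m} (hw : ρ x = w)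
    (hs : ρ y < D.codeBound) (hs' : ρ y' < D.codeBound) :
    (overlap x y y').eval M ρ ≠ 0 ↔ ¬ Disjoint (D.decode w (ρ y)) (D.decode w (ρ y')) := by
  rw [overlap, eval_sum_fin _ _ _ hρ.one, ← not_iff_not, not_not, not_not,
    Finset.sum_eq_zero_iff, Finset.disjoint_left]
  simp only [Finset.mem_univ, true_imp_iff]
  refine forall_congr' fun v => ?_
  have hρ' := hρ.update (x := 8) (by norm_num) v
  rw [eval_ite, eval_elem hM hρ' (x := x) (y := y) (z := 8) (w := w) (v := v) hx.2 (by norm_num)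
    (by simp [hx.1, hw]) (by simp) (by simpa [hy] using hs),
    eval_elem hM hρ' (x := x) (y := y') (z := 8) (w := w) (v := v) hx.2 (by norm_num)
    (by simp [hx.1, hw]) (by simp) (by simpa [hy'] using hs')]
  by_cases ha : v ∈ D.decode w (ρ y) <;> by_cases hb : v ∈ D.decode w (ρ y') <;>
    simp [ha, hb, hy, hy']

theorem eval_nonadj (hM : ContainsInput D M) (hρ : IsEnv D ρ) {x y : ℕ}
    (hx : x ≠ 8 ∧ x ≠ 9 ∧ x ≠ 11 ∧ x ≠ 12) (hy : y ≠ 8 ∧ y ≠ 9) {w : Fin m} (hw : ρ x = w)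
    (hs : ρ y < D.codeBound) :
    (nonadj x y).eval M ρ ≠ 0 ↔ ¬ G.IsClique (D.decode w (ρ y)) := by
  rw [nonadj, eval_sum_fin _ _ _ hρ.one, ← not_iff_not, not_not, not_not,
    Finset.sum_eq_zero_iff, SimpleGraph.isClique_iff, Set.Pairwise]
  simp only [Finset.mem_univ, true_imp_iff, Finset.mem_coe]
  refine forall_congr' fun u => ?_
  have hρ' := hρ.update (x := 8) (by norm_num) u
  rw [eval_sum_fin _ _ _ hρ'.one, Finset.sum_eq_zero_iff, imp_forall_iff]
  simp only [Finset.mem_univ, true_imp_iff]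
  refine forall_congr' fun v : Fin n => ?_
  have hρ'' := hρ'.update (x := 9) (by norm_num) v
  have h1 := eval_elem hM hρ'' (x := x) (y := y) (z := 8) (w := w) (v := u) hx.2.2 (by norm_num)
    (by simp [hx, hw]) (by simp) (by simpa [hy] using hs)
  have h2 := eval_elem hM hρ'' (x := x) (y := y) (z := 9) (w := w) (v := v) hx.2.2 (by norm_num)
    (by simp [hx, hw]) (by simp) (by simpa [hy] using hs)
  have h3 := eval_adj hM hρ'' (x := 8) (y := 9) (u := u) (v := v) (by simp) (by simp)
  have h4 := eval_ne_ne_zero (M := M) (ρ := Function.update (Function.update ρ 8 u) 9 v)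
    (var 8) (var 9)
  simp only [eval_ite, h1, h2, h3, h4, eval_sub, eval_var, eval_zero, eval_one]
  by_cases ha : u ∈ D.decode w (ρ y) <;> by_cases hb : v ∈ D.decode w (ρ y) <;>
    by_cases hc : G.Adj u v <;> simp [ha, hb, hc, hy, Fin.val_inj]


/-- All codes are tried as candidates for a clique. A set may have several codes, so only the
vanishing of the count is meaningful. -/
theorem eval_cliques (hM : ContainsInput D M) (hρ : IsEnv D ρ) (h : ℕ) {x y : ℕ}
    (hx : x ≤ 7) (hy : y ≤ 7) {w : Fin m} (hw : ρ x = w) (hs : ρ y < D.codeBound) :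
    (cliques h x y).eval M ρ ≠ 0 ↔
      ∃ K, G.IsNClique h K ∧ K ⊆ D.bag w ∧ Disjoint K (D.decode w (ρ y)) := by
  have hval : ∀ q < D.codeBound, (ite (ne (size x 14) (const h)) zero (ite (overlap x 14 y) zero
      (ite (nonadj x 14) zero one))).eval M (Function.update ρ 14 q) ≠ 0 ↔
      G.IsNClique h (D.decode w q) ∧ Disjoint (D.decode w q) (D.decode w (ρ y)) := by
    intro q hq
    have hρ' := hρ.update (x := 14) (by norm_num) q
    have hw' : Function.update ρ 14 q x = w := by rwa [Function.update_of_ne (by omega)]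
    have hq' : Function.update ρ 14 q 14 = q := by simp
    have hs' : Function.update ρ 14 q y = ρ y := by rw [Function.update_of_ne (by omega)]
    have h1 := eval_ne_ne_zero (M := M) (ρ := Function.update ρ 14 q) (size x 14) (const h)
    rw [eval_size hM hρ' (by omega) (by norm_num) hw' (by rwa [hq']), eval_const, hq'] at h1
    have h2 := eval_overlap hM hρ' (x := x) (y := 14) (y' := y) (by omega) (by norm_num) (by omega)
      hw' (by rwa [hq']) (by rwa [hs'])
    rw [hq', hs'] at h2
    have h3 := eval_nonadj hM hρ' (x := x) (y := 14) (by omega) (by norm_num) hw' (by rwa [hq'])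
    rw [hq'] at h3
    simp only [eval_ite, h1, h2, h3, eval_zero, eval_one, SimpleGraph.isNClique_iff]
    split_ifs <;> simp_all
  rw [cliques, eval_sum, hρ.three, Ne, Finset.sum_eq_zero_iff]
  push Not
  constructor
  · rintro ⟨q, hq, hne⟩
    obtain ⟨h1, h2⟩ := (hval q (Finset.mem_range.1 hq)).1 hne
    exact ⟨_, h1, D.decode_subset w q, h2⟩
  · rintro ⟨K, h1, h2, h3⟩
    obtain ⟨q, hq, rfl⟩ := D.exists_lt_codeBound_decode_eq w K h2
    exact ⟨q, Finset.mem_range.2 hq, (hval q hq).2 ⟨h1, h3⟩⟩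

theorem eval_weight (hM : ContainsInput D M) (hρ : IsEnv D ρ) (h : ℕ) {x y : ℕ}
    (hx : x ≤ 7) (hy : y ≤ 7) {w : Fin m} (hw : ρ x = w) (hs : ρ y < D.codeBound) :
    (weight h x y).eval M ρ = D.weight h w (D.decode w (ρ y)) := by
  classical
  rw [weight, eval_plus, eval_ite, TreeDecomposition.weight, eval_plus, eval_one, eval_zero,
    eval_var, hρ.one, Fintype.card_fin]
  congr 1
  · rw [eval_sum_fin _ _ _ hρ.one, ← Finset.filter_univ_mem (D.decode w (ρ y)),
      Finset.filter_filter, Finset.card_filter]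
    refine Finset.sum_congr rfl fun v _ => ?_
    have hρ' := hρ.update (x := 8) (by norm_num) v
    have hfirst : (sum 9 x (bag 9 8)).eval M (Function.update ρ 8 v) ≠ 0 ↔
        ¬ ∀ u < w, v ∉ D.bag u := by
      have hbag : ∀ u : Fin m, (bag 9 8).eval M (Function.update (Function.update ρ 8 v) 9 u) =
          if v ∈ D.bag u then 1 else 0 := fun u =>
        eval_bag hM (hρ'.update (by norm_num) u).isPreEnv (by simp) (by simp)
      rw [eval_sum, Function.update_of_ne (by omega), hw, not_iff_not, Finset.sum_eq_zero_iff]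
      constructor
      · intro hu u huw
        simpa [hbag u] using hu u (Finset.mem_range.2 huw)
      · intro hu u huw
        rw [Finset.mem_range] at huw
        rw [hbag ⟨u, huw.trans w.2⟩, if_neg (hu _ huw)]
    rw [eval_ite, eval_ite, eval_elem hM hρ' (w := w) (v := v) (by omega) (by norm_num)
      (by rw [Function.update_of_ne (by omega), hw]) (by simp)
      (by rwa [Function.update_of_ne (by omega)]), Function.update_of_ne (by omega)]
    simp only [hfirst, eval_zero, eval_one]
    split_ifs <;> simp_all
  · simp only [eval_cliques hM hρ h hx hy hw hs]

theorem eval_codeBound (hM : ContainsInput D M) (hρ : IsPreEnv n m ρ) :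
    codeBound.eval M ρ = D.codeBound := by
  rw [codeBound, eval, eval_zero, hρ.two, TreeDecomposition.codeBound]
  refine (iter_max _ _).trans ?_
  have hval : ∀ w : Fin m, (fold .dbl 8 1 one (bag 4 8)).eval M (Function.update ρ 4 w) =
      2 ^ (D.bag w).card := fun w => by
    have hρ' := hρ.update (x := 4) (by norm_num) w
    rw [eval, eval_one, hρ'.one, iter_dbl_bag hM hρ' (by norm_num) (by norm_num) (w := w)
      (by simp) le_rfl, D.rank_eq_card]
  refine le_antisymm (Finset.sup_le fun i hi => ?_) (Finset.sup_le fun w _ => ?_)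
  · rw [hval ⟨i, Finset.mem_range.1 hi⟩]
    exact Finset.le_sup (f := fun w => 2 ^ (D.bag w).card) (Finset.mem_univ _)
  · rw [← hval w]
    exact Finset.le_sup (f := fun i => (fold .dbl 8 1 one (bag 4 8)).eval M
      (Function.update ρ 4 i)) (Finset.mem_range.2 w.2)

end Expr

end Eval

end RAM

/-! ## The table -/

namespace TreeDecomposition

variable {n m : ℕ} {G : SimpleGraph (Fin n)} (D : TreeDecomposition G (Fin m))

open Classical in
/-- The minimum entry of the row `g` of `w` that is compatible with the code `s` for `p`. -/
noncomputable def message (g : ℕ → ℕ) (w p : Fin m) (s : ℕ) : ℕ :=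
  RAM.iter D.codeBound (fun s' a => min a (if D.Compat w p (D.decode w s') (D.decode p s) then g s'
    else ∑ i ∈ Finset.range D.codeBound, g i)) (∑ i ∈ Finset.range D.codeBound, g i)

theorem message_le {g : ℕ → ℕ} {w p : Fin m} {s s' : ℕ} (hs' : s' < D.codeBound)
    (hc : D.Compat w p (D.decode w s') (D.decode p s)) : D.message g w p s ≤ g s' := by
  refine (RAM.iter_min_le _ _ hs').trans ?_
  rw [if_pos hc]

/-- The code of `decode p s ∩ bag w` is always compatible, and its entry is at most the row sum. So
even if the minimum equals the row sum, it is attained at a compatible code. -/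
theorem exists_message_eq (g : ℕ → ℕ) (w p : Fin m) (s : ℕ) : ∃ s' < D.codeBound,
    D.Compat w p (D.decode w s') (D.decode p s) ∧ D.message g w p s = g s' := by
  classical
  obtain ⟨s', hs', hdec⟩ := D.exists_lt_codeBound_decode_eq w (D.decode p s ∩ D.bag w)
    Finset.inter_subset_right
  have hc : D.Compat w p (D.decode w s') (D.decode p s) := fun v hw _ => by simp [hdec, hw]
  have hle : g s' ≤ ∑ i ∈ Finset.range D.codeBound, g i :=
    Finset.single_le_sum (fun _ _ => Nat.zero_le _) (Finset.mem_range.2 hs')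
  have hsum : D.message g w p s = ∑ i ∈ Finset.range D.codeBound, g i →
      D.message g w p s = g s' := fun h => le_antisymm (D.message_le hs' hc) (h ▸ hle)
  rcases RAM.iter_min_eq _ _ _ with h | ⟨q, hq, h⟩
  · exact ⟨s', hs', hc, hsum h⟩
  · by_cases hcq : D.Compat w p (D.decode w q) (D.decode p s)
    · exact ⟨q, hq, hcq, h.trans (if_pos hcq)⟩
    · exact ⟨s', hs', hc, hsum (h.trans (if_neg hcq))⟩

/-- `w` is a leaf of the remaining tree. -/
def IsLeaf (A : Finset (Fin m)) (w : Fin m) : Prop :=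
  w ∈ A ∧ ∃! p, p ∈ A ∧ D.tree.Adj w p

open Classical in
/-- The table after the elimination of the leaf `w`. -/
noncomputable def passMessage (A : Finset (Fin m)) (f : Fin m → ℕ → ℕ) (w p : Fin m) (s : ℕ) : ℕ :=
  f p s + if p ∈ A ∧ D.tree.Adj w p then D.message (f w) w p s else 0

variable {D} in
theorem IsTable.passMessage {k : ℕ} {A : Finset (Fin m)} {f : Fin m → ℕ → ℕ} {w : Fin m}
    (hf : D.IsTable D.codeBound D.decode k A f) (hw : D.IsLeaf A w) :
    D.IsTable D.codeBound D.decode k (A.erase w) (D.passMessage A f w) := by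
  obtain ⟨hwA, p, ⟨hp, hwp⟩, huniq⟩ := hw
  refine hf.erase hwA hp hwp (fun q hq hwq => huniq q ⟨hq, hwq⟩) (msg := D.message (f w) w p)
    (fun u hu _ hup s _ => ?_) (fun s _ => ?_) (fun s _ s' hs' hc => D.message_le hs' hc)
    (fun s _ => D.exists_message_eq (f w) w p s)
  · rw [TreeDecomposition.passMessage, if_neg fun h => hup (huniq u h), add_zero]
  · rw [TreeDecomposition.passMessage, if_pos ⟨hp, hwp⟩]

end TreeDecomposition

/-! ### The table in memory -/

namespace RAM

variable {n m : ℕ} {G : SimpleGraph (Fin n)} {D : TreeDecomposition G (Fin m)}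

variable (D) in
/-- The memory contains the input, the set of the remaining nodes, and the table. -/
structure Represents (A : Finset (Fin m)) (f : Fin m → ℕ → ℕ) (M : ℕ → ℕ) : Prop where
  input : ContainsInput D M
  alive : ∀ w : Fin m, M ((encodeInput G D).length + w) = if w ∈ A then 1 else 0
  table : ∀ w : Fin m, ∀ s < D.codeBound,
    M ((encodeInput G D).length + m + (w * D.codeBound + s)) = f w s

variable {A : Finset (Fin m)} {f : Fin m → ℕ → ℕ} {M ρ : ℕ → ℕ} {k : ℕ}

namespace Represents

theorem congr (hM : Represents D A f M) {f' : Fin m → ℕ → ℕ}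
    (h : ∀ w, ∀ s < D.codeBound, f w s = f' w s) : Represents D A f' M :=
  ⟨hM.input, hM.alive, fun w s hs => (hM.table w s hs).trans (h w s hs)⟩

theorem store_table (hM : Represents D A f M) (p : Fin m) {s : ℕ} (hs : s < D.codeBound) (x : ℕ) :
    Represents D A (fun u t => if u = p ∧ t = s then x else f u t)
      (Function.update M ((encodeInput G D).length + m + (p * D.codeBound + s)) x) := by
  refine ⟨fun i hi => ?_, fun w => ?_, fun w t ht => ?_⟩
  · rw [Function.update_of_ne (by omega), hM.input i hi]
  · rw [Function.update_of_ne (by omega), hM.alive w]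
  · by_cases h : w = p ∧ t = s
    · obtain ⟨rfl, rfl⟩ := h
      simp
    · rw [if_neg h, Function.update_of_ne, hM.table w t ht]
      intro heq
      have heq' : (w : ℕ) * D.codeBound + t = p * D.codeBound + s := by omega
      -- Division recovers the row from the offset, so distinct entries have distinct addresses.
      have hdiv : ∀ q r : ℕ, r < D.codeBound → (q * D.codeBound + r) / D.codeBound = q :=
        fun q r hr => by
          rw [add_comm, Nat.add_mul_div_right _ _ (by omega), Nat.div_eq_of_lt hr, zero_add]
      have hwp : (w : ℕ) = p := by rw [← hdiv w t ht, heq', hdiv p s hs]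
      rw [hwp] at heq'
      exact h ⟨Fin.ext hwp, by omega⟩

theorem store_alive (hM : Represents D A f M) (w : Fin m) {x : ℕ} {A' : Finset (Fin m)}
    (hw : x = if w ∈ A' then 1 else 0) (hA' : ∀ u, u ≠ w → (u ∈ A' ↔ u ∈ A)) :
    Represents D A' f (Function.update M ((encodeInput G D).length + w) x) := by
  refine ⟨fun i hi => ?_, fun u => ?_, fun u t ht => ?_⟩
  · rw [Function.update_of_ne (by omega), hM.input i hi]
  · by_cases h : u = w
    · subst h; simpa using hw
    · rw [Function.update_of_ne (fun heq => h (Fin.ext (by omega))), hM.alive u]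
      simp only [hA' u h]
  · rw [Function.update_of_ne (by omega), hM.table u t ht]

end Represents

namespace Expr

theorem eval_aliveAddr (x : ℕ) (hρ : IsEnv D ρ) :
    (aliveAddr x).eval M ρ = (encodeInput G D).length + ρ x := by
  simp [aliveAddr, hρ.zero]

theorem eval_tableAddr (x y : ℕ) (hρ : IsEnv D ρ) :
    (tableAddr x y).eval M ρ = (encodeInput G D).length + m + (ρ x * D.codeBound + ρ y) := by
  simp [tableAddr, hρ.zero, hρ.two, hρ.three]

theorem eval_alive (hM : Represents D A f M) (hρ : IsEnv D ρ) {x : ℕ} {w : Fin m} (hw : ρ x = w) :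
    (alive x).eval M ρ = if w ∈ A then 1 else 0 := by
  rw [alive, eval_mem, eval_aliveAddr x hρ, hw, hM.alive]

theorem eval_table (hM : Represents D A f M) (hρ : IsEnv D ρ) {x y : ℕ} {w : Fin m}
    (hw : ρ x = w) (hs : ρ y < D.codeBound) : (table x y).eval M ρ = f w (ρ y) := by
  rw [table, eval_mem, eval_tableAddr x y hρ, hw, hM.table w _ hs]

theorem eval_rowSum (hM : Represents D A f M) (hρ : IsEnv D ρ) {x : ℕ} (hx : x ≠ 10) {w : Fin m}
    (hw : ρ x = w) : (rowSum x).eval M ρ = ∑ i ∈ Finset.range D.codeBound, f w i := by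
  rw [rowSum, eval_sum, hρ.three]
  refine Finset.sum_congr rfl fun i hi => ?_
  rw [eval_table hM (hρ.update (by norm_num) i) (w := w) (by simp [hx, hw])
    (by simpa using hi)]
  simp

theorem eval_message (hM : Represents D A f M) (hρ : IsEnv D ρ) {x y z : ℕ}
    (hx : x ≤ 7) (hy : y ≤ 7) (hz : z ≤ 7) {w p : Fin m} (hw : ρ x = w) (hp : ρ y = p)
    (hs : ρ z < D.codeBound) :
    (message x y z).eval M ρ = D.message (f w) w p (ρ z) := by
  classical
  rw [message, eval, eval_rowSum hM hρ (by omega) hw, hρ.three, TreeDecomposition.message]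
  refine iter_congr fun s' hs' a => ?_
  have hρ' := hρ.update (x := 10) (by norm_num) s'
  have hw' : Function.update ρ 10 s' x = w := by rwa [Function.update_of_ne (by omega)]
  have h10 : Function.update ρ 10 s' 10 = s' := by simp
  have hz' : Function.update ρ 10 s' z = ρ z := by rw [Function.update_of_ne (by omega)]
  have hinc := eval_incompat hM.input hρ' (x := x) (x' := y) (y := 10) (y' := z) (w := w) (p := p)
    (by omega) (by omega) (by norm_num) (by omega) hw' (by rwa [Function.update_of_ne (by omega)])
    (by rwa [h10]) (by rwa [hz'])
  rw [h10, hz'] at hinc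
  rw [eval_ite, eval_rowSum hM hρ' (by omega) hw', eval_table hM hρ' hw' (by rwa [h10]), h10]
  simp only [hinc, ite_not]
  rfl

theorem eval_leaf (hM : Represents D A f M) (hρ : IsEnv D ρ) {x : ℕ} (hx : x ≠ 9) {w : Fin m}
    (hw : ρ x = w) : (leaf x).eval M ρ ≠ 0 ↔ D.IsLeaf A w := by
  classical
  have hdeg : (sum 9 2 (ite (alive 9) (tree x 9) zero)).eval M ρ =
      (Finset.univ.filter fun p => p ∈ A ∧ D.tree.Adj w p).card := by
    rw [eval_sum_fin _ _ _ hρ.two, Finset.card_filter]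
    refine Finset.sum_congr rfl fun p _ => ?_
    have hρ' := hρ.update (x := 9) (by norm_num) p
    rw [eval_ite, eval_alive hM hρ' (w := p) (by simp),
      eval_tree hM.input hρ' (w := w) (p := p) (by simp [hx, hw]) (by simp), eval_zero]
    by_cases hp : p ∈ A <;> simp [hp]
  have hne := eval_ne_ne_zero (M := M) (ρ := ρ) (sum 9 2 (ite (alive 9) (tree x 9) zero)) one
  rw [hdeg, eval_one] at hne
  have huniq : (∃! p, p ∈ A ∧ D.tree.Adj w p) ↔
      (Finset.univ.filter fun p => p ∈ A ∧ D.tree.Adj w p).card = 1 := by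
    rw [Finset.card_eq_one, ExistsUnique]
    simp [Finset.eq_singleton_iff_unique_mem]
  rw [leaf, eval_ite, eval_ite, eval_alive hM hρ hw, TreeDecomposition.IsLeaf, huniq]
  simp only [hne, eval_zero, eval_one]
  by_cases hwA : w ∈ A <;> simp [hwA]

/-- With a single remaining node, the sum over the remaining nodes selects its row without having to
locate it. -/
theorem eval_output {w : Fin m} (hM : Represents D {w} f M) (hρ : IsEnv D ρ)
    (hf : D.IsTable D.codeBound D.decode k {w} f) (c : ℕ) :
    (output c).eval M ρ = min (n - c) k := by
  have hval : ∀ s < D.codeBound, (sum 4 2 (ite (alive 4) (table 4 6) zero)).eval M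
      (Function.update ρ 6 s) = f w s := by
    intro s hs
    have hρ' := hρ.update (x := 6) (by norm_num) s
    rw [eval_sum_fin _ _ _ hρ'.two, Finset.sum_eq_single w]
    · rw [eval_ite, eval_alive hM (hρ'.update (by norm_num) w) (w := w) (by simp),
        eval_table hM (hρ'.update (by norm_num) w) (w := w) (by simp) (by simpa)]
      simp
    · intro u _ huw
      rw [eval_ite, eval_alive hM (hρ'.update (by norm_num) u) (w := u) (by simp)]
      simp [huw]
    · simp
  rw [output, eval, hρ.three, eval_sub, eval_var, eval_const, hρ.one]
  refine (iter_congr (g := fun s a => min a (f w s)) fun s hs a => ?_).trans ?_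
  · rw [hval s hs]
    rfl
  · obtain ⟨⟨s, hs, hk⟩, hlow⟩ := hf.isLeast
    refine le_antisymm (le_min (iter_min_le_init _ _ _) (hk ▸ iter_min_le _ _ hs)) ?_
    rcases iter_min_eq (fun s => f w s) D.codeBound (n - c) with h | ⟨i, hi, h⟩
    · exact h.symm ▸ min_le_left _ _
    · exact h.symm ▸ (min_le_right _ _).trans (hlow ⟨i, hi, rfl⟩)

end Expr

/-! ## The statements of the algorithm -/

namespace Stmt

open RAM.Expr

/-- Compute all entries of the table. -/
def fill (e : Expr) : Stmt := forLoop 5 2 (forLoop 6 3 (store (tableAddr 5 6) e))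

def initAlive : Stmt := forLoop 4 2 (store (aliveAddr 4) Expr.one)

/-- Eliminate the node in variable `4` if it is a leaf. -/
def eliminate : Stmt :=
  ifThen (leaf 4) <| .seq
    (fill (plus (table 5 6) (Expr.ite (alive 5) (Expr.ite (tree 4 5) (message 4 5 6) zero) zero)))
    (store (aliveAddr 4) zero)

def sweep : Stmt := forLoop 4 2 eliminate

/-- `m` sweeps suffice, since each removes a node as long as two or more remain. -/
def main (h : ℕ) : Stmt := seq initAlive (seq (fill (weight h 5 6)) (forLoop 7 2 sweep))

/-- The table is overwritten in place, so `e` is evaluated on a mixture `f'` of old and new entries.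
The hypothesis `he` asks for the right value on every such mixture whose entry at `(p, s)` is still
old. -/
theorem represents_fill {e : Expr} {F : Fin m → ℕ → ℕ} (hM : Represents D A f M)
    (hρ : IsEnv D ρ) (he : ∀ (p : Fin m) (s : ℕ), s < D.codeBound → ∀ M' f', Represents D A f' M' →
      (∀ u t, f' u t = f u t ∨ f' u t = F u t) → f' p s = f p s →
      e.eval M' (Function.update (Function.update ρ 5 p) 6 s) = F p s) :
    Represents D A F ((fill e).run ρ M) := by
  classical
  rw [fill, run, hρ.two]
  refine (iter_induction (fun i M' => Represents D A (fun u t => if (u : ℕ) < i then F u t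
    else f u t) M') (by simpa using hM) fun i hi M' hM' => ?_).congr (by simp)
  have hρ' := hρ.update (x := 5) (by norm_num) i
  rw [run, hρ'.three]
  refine (iter_induction (fun j M' => Represents D A (fun u t => if (u : ℕ) < i ∨ (u : ℕ) = i ∧ t < j
    then F u t else f u t) M') (by simpa using hM') fun j hj M' hM' => ?_).congr ?_
  · have hval := he ⟨i, hi⟩ j hj M' _ hM' (fun u t => by split_ifs <;> simp) (by simp)
    rw [run, eval_tableAddr _ _ (hρ'.update (by norm_num) j), hval]
    rw [Function.update_self, Function.update_of_ne (by norm_num), Function.update_self]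
    refine (hM'.store_table ⟨i, hi⟩ hj _).congr fun u t _ => ?_
    simp only [Fin.ext_iff]
    by_cases hu : (u : ℕ) = i
    · obtain rfl : u = ⟨i, hi⟩ := Fin.ext hu
      rcases lt_trichotomy t j with ht | ht | ht
      · simp [ht, ht.ne, ht.trans (Nat.lt_succ_self j)]
      · simp [ht]
      · simp [ht.ne', not_lt.2 ht.le, show ¬ t < j + 1 by omega]
    · simp [hu]
  · intro u t ht
    simp only [ht, and_true]
    simp [le_iff_lt_or_eq]

theorem represents_initAlive (hM : Represents D ∅ f M) (hρ : IsEnv D ρ) :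
    Represents D Finset.univ f (initAlive.run ρ M) := by
  rw [initAlive, run, hρ.two]
  have := iter_induction (n := m) (a := M)
    (f := fun i M' => (store (aliveAddr 4) Expr.one).run (Function.update ρ 4 i) M')
    (fun i M' => Represents D {u : Fin m | (u : ℕ) < i} f M') (by simpa using hM)
    fun i hi M' hM' => by
      rw [run, eval_aliveAddr 4 (hρ.update (by norm_num) i), Function.update_self, eval_one]
      refine hM'.store_alive ⟨i, hi⟩ (by simp) fun u hu => ?_
      have : (u : ℕ) ≠ i := fun h => hu (Fin.ext h)
      simp only [Finset.mem_filter, Finset.mem_univ, true_and]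
      omega
  simpa using this

theorem represents_eliminate (hM : Represents D A f M) (hρ : IsEnv D ρ) {w : Fin m}
    (hw : ρ 4 = w) (hleaf : D.IsLeaf A w) :
    Represents D (A.erase w) (D.passMessage A f w) (eliminate.run ρ M) := by
  classical
  rw [eliminate, run, if_pos ((eval_leaf hM hρ (by norm_num) hw).2 hleaf), run]
  have hfill : Represents D A (D.passMessage A f w) _ := represents_fill
    (e := plus (table 5 6) (Expr.ite (alive 5) (Expr.ite (tree 4 5) (message 4 5 6) zero) zero))
    hM hρ fun p s hs M' f' hM' hf' hps => ?_
  · rw [run, eval_aliveAddr 4 hρ, hw, eval_zero]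
    exact hfill.store_alive w (by simp) fun u hu => by simp [hu]
  · have hρ' := (hρ.update (x := 5) (by norm_num) p).update (x := 6) (by norm_num) s
    -- No node is adjacent to itself, so the row of `w` does not change while its messages are
    -- computed from it.
    have hrow : f' w = f w := funext fun t => (hf' w t).elim id fun h =>
      h.trans (by simp [TreeDecomposition.passMessage])
    rw [eval_plus, eval_ite, eval_ite, eval_zero,
      eval_table hM' hρ' (w := p) (by simp) (by simpa),
      eval_alive hM' hρ' (w := p) (by simp),
      eval_tree hM'.input hρ' (w := w) (p := p) (by simp [hw]) (by simp),
      eval_message hM' hρ' (w := w) (p := p) (by norm_num) (by norm_num) (by norm_num)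
        (by simp [hw]) (by simp) (by simpa), hrow, TreeDecomposition.passMessage]
    simp only [Function.update_self, hps]
    by_cases h1 : p ∈ A <;> by_cases h2 : D.tree.Adj w p <;> simp [h1, h2]

variable (D) in
/-- The memory contains a table with the remaining nodes `A`. -/
def ContainsTable (k : ℕ) (A : Finset (Fin m)) (M : ℕ → ℕ) : Prop :=
  ∃ f, Represents D A f M ∧ D.IsTable D.codeBound D.decode k A f

/-- If a sweep removes nothing, no remaining node is a leaf, and then at most one node remains. -/
theorem containsTable_sweep (hM : ContainsTable D k A M) (hρ : IsEnv D ρ) :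
    ∃ A', ContainsTable D k A' (sweep.run ρ M) ∧ (A'.card < A.card ∨ A'.card ≤ 1) := by
  classical
  rw [sweep, run, hρ.two]
  obtain ⟨A', hM', hsub, hA'⟩ := iter_induction (n := m) (a := M)
    (f := fun i M' => eliminate.run (Function.update ρ 4 i) M')
    (fun i M' => ∃ A', ContainsTable D k A' M' ∧ A' ⊆ A ∧
      -- Equality means that nothing has been removed so far, so all nodes visited were tested
      -- against `A` itself.
      (A' = A → ∀ u : Fin m, (u : ℕ) < i → ¬ D.IsLeaf A u))
    ⟨A, hM, Finset.Subset.refl A, by simp⟩ (by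
      rintro i hi M' ⟨A', ⟨f, hM', hf⟩, hsub, hA'⟩
      have hρ' := hρ.update (x := 4) (by norm_num) i
      by_cases hleaf : D.IsLeaf A' ⟨i, hi⟩
      · refine ⟨_, ⟨_, represents_eliminate hM' hρ' (by simp) hleaf, hf.passMessage hleaf⟩,
          (Finset.erase_subset _ _).trans hsub, fun h => ?_⟩
        have := (h.symm ▸ hsub) hleaf.1
        simp at this
      · refine ⟨A', ⟨f, ?_, hf⟩, hsub, fun h u hu => ?_⟩
        · rwa [eliminate, run, if_neg]
          rwa [eval_leaf hM' hρ' (by norm_num) (w := ⟨i, hi⟩) (by simp)]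
        · rcases Nat.lt_succ_iff_lt_or_eq.1 hu with hu | rfl
          · exact hA' h u hu
          · exact h ▸ hleaf)
  refine ⟨A', hM', ?_⟩
  by_cases h : A' = A
  · subst h
    by_contra! hcard
    obtain ⟨f, -, hf⟩ := hM
    obtain ⟨w, hw⟩ := D.isTree.exists_leaf_induce hf.connected (by omega)
    exact hA' rfl w w.2 hw
  · exact .inl (Finset.card_lt_card (hsub.ssubset_of_ne h))

theorem containsTable_main {h : ℕ} (hM : Represents D ∅ f M) (hρ : IsEnv D ρ)
    (hk : IsLeast {j | ∃ X, HitsCliques h G X ∧ X.card = j} k) :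
    ∃ w, ContainsTable D k {w} ((main h).run ρ M) := by
  rw [main, run, run]
  have hM₁ : Represents D Finset.univ (fun w s => D.weight h w (D.decode w s))
      ((fill (weight h 5 6)).run ρ (initAlive.run ρ M)) := by
    refine represents_fill (represents_initAlive hM hρ) hρ fun p s hs M' f' hM' _ _ => ?_
    rw [eval_weight hM'.input ((hρ.update (by norm_num) p).update (by norm_num) s) h (by norm_num)
      (by norm_num) (w := p) (by simp) (by simpa)]
    simp
  have hT := D.isTable_weight D.decode_subset D.exists_lt_codeBound_decode_eq hk
  rw [run, hρ.two]
  obtain ⟨A, hA, hcard⟩ := iter_induction (n := m)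
    (a := (fill (weight h 5 6)).run ρ (initAlive.run ρ M))
    (f := fun i M' => sweep.run (Function.update ρ 7 i) M')
    (fun i M' => ∃ A, ContainsTable D k A M' ∧ (A.card + i ≤ m ∨ A.card ≤ 1))
    ⟨Finset.univ, ⟨_, hM₁, hT⟩, by simp⟩ (by
      rintro i hi M' ⟨A, hA, hcard⟩
      obtain ⟨A', hA', hcard'⟩ := containsTable_sweep hA (hρ.update (x := 7) (by norm_num) i)
      exact ⟨A', hA', by omega⟩)
  have hne : A.Nonempty := by
    obtain ⟨f, -, hf⟩ := hA
    obtain ⟨⟨w, hw⟩⟩ := hf.connected.nonempty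
    exact ⟨w, hw⟩
  have := hne.card_pos
  obtain ⟨w, rfl⟩ := Finset.card_eq_one.1 (show A.card = 1 by omega)
  exact ⟨w, hA⟩

end Stmt

/-! ## The program -/

open RAM.Expr in
/-- The program for `K_h + I_l`. -/
def hittingProgram (h l : ℕ) : Program :=
  .seq (assign 1 (mem zero) 16) <| .seq (assign 2 (mem Expr.one) 16) <|
  .seq (assign 3 codeBound 16) <| .seq ((Stmt.main h).code 16) <|
  assign 0 (output (h + l - 1)) 16

/-- A bound for the running time. -/
def hittingCost (h l B : ℕ) : ℕ :=
  ((Expr.mem Expr.zero).cost B + 1) + (((Expr.mem Expr.one).cost B + 1) +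
    ((Expr.codeBound.cost B + 1) + ((Stmt.main h).cost B +
      ((Expr.output (h + l - 1)).cost B + 1))))

theorem polyBounded_hittingCost (h l : ℕ) : PolyBounded (hittingCost h l) :=
  ((Expr.polyBounded_cost _).add (.const 1)).add <|
    ((Expr.polyBounded_cost _).add (.const 1)).add <|
    ((Expr.polyBounded_cost _).add (.const 1)).add <|
    (Stmt.polyBounded_cost _).add ((Expr.polyBounded_cost _).add (.const 1))

theorem runs_hittingProgram (h l : ℕ)
    (hk : IsLeast {j | ∃ X, HitsCliques h G X ∧ X.card = j} k) {B : ℕ}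
    (hN : (encodeInput G D).length ≤ B) (hQ : D.codeBound ≤ B) :
    Runs (hittingProgram h l) (init (encodeInput G D)) (hittingCost h l B)
      fun s => s.reg 0 = min (n - (h + l - 1)) k := by
  have hlen := length_encodeInput D
  have hM : ContainsInput D (init (encodeInput G D)).mem := fun i _ => rfl
  -- The input contains matrices with `n * n` and `m * m` entries, so `n` and `m` are at most its
  -- length.
  have hsq : ∀ a : ℕ, a ≤ a * a := fun a => by
    rcases Nat.eq_zero_or_pos a with rfl | ha
    · simp
    · exact Nat.le_mul_of_pos_left a ha
  have hnB := hsq n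
  have hmB := hsq m
  have hreg : ∀ j < 16, (init (encodeInput G D)).reg j =
      if j = 0 then (encodeInput G D).length else 0 := fun j _ => by
    by_cases hj : j = 0
    · subst hj; simp [init]
    · simp [init, hj]
  have hzero : ∀ i, (encodeInput G D).length ≤ i → (init (encodeInput G D)).mem i = 0 :=
    fun i hi => List.getD_eq_default _ _ hi
  generalize init (encodeInput G D) = s₀ at hM hreg hzero ⊢
  refine Runs.seq (runs_assign 1 (by simp [Expr.Below, Expr.zero]) s₀ fun j hj => ?_)
    fun s₁ ⟨hm₁, hr₁⟩ => ?_
  · rw [hreg j hj]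
    split_ifs <;> omega
  have hv₁ : (Expr.mem Expr.zero).eval s₀.mem s₀.reg = n := hM.zero
  rw [hv₁] at hr₁
  refine Runs.seq (runs_assign (B := B) 2 (by simp [Expr.Below, Expr.one]) s₁ fun j hj => ?_)
    fun s₂ ⟨hm₂, hr₂⟩ => ?_
  · rw [hr₁ j hj, Function.update_apply, hreg j hj]
    split_ifs <;> omega
  have hv₂ : (Expr.mem Expr.one).eval s₁.mem s₁.reg = m := by
    rw [hm₁]; exact hM.one
  rw [hv₂] at hr₂
  have hr₂' : ∀ j < 16, s₂.reg j ≤ B := fun j hj => by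
    rw [hr₂ j hj, Function.update_apply, hr₁ j hj, Function.update_apply, hreg j hj]
    split_ifs <;> omega
  refine Runs.seq (runs_assign (B := B) 3 ?_ s₂ hr₂') fun s₃ ⟨hm₃, hr₃⟩ => ?_
  · simp [Expr.Below, Expr.codeBound, Expr.zero, Expr.one, Expr.bag, Expr.plus, Expr.mul, Expr.sum]
  have hv₃ : Expr.codeBound.eval s₂.mem s₂.reg = D.codeBound := by
    refine Expr.eval_codeBound (by rw [hm₂, hm₁]; exact hM) ⟨?_, ?_⟩
    · rw [hr₂ 1 (by norm_num)]; simp [hr₁ 1]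
    · rw [hr₂ 2 (by norm_num)]; simp
  rw [hv₃] at hr₃
  have hr₃' : ∀ j < 16, s₃.reg j ≤ B := fun j hj => by
    have := hr₂' j hj
    rw [hr₃ j hj, Function.update_apply]
    split_ifs <;> omega
  have hρ₃ : IsEnv D s₃.reg := by
    constructor
    · simp [hr₃ 0, hr₂ 0, hr₁ 0, hreg 0]
    · simp [hr₃ 1, hr₂ 1, hr₁ 1]
    · simp [hr₃ 2, hr₂ 2]
    · simp [hr₃ 3]
  have hmem : s₃.mem = s₀.mem := by rw [hm₃, hm₂, hm₁]
  refine Runs.seq (Stmt.runs_code (B := B) (K := 16) ?_ 16 le_rfl s₃ hr₃') fun s₄ ⟨hm₄, hr₄⟩ => ?_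
  · simp [Stmt.main, Stmt.initAlive, Stmt.fill, Stmt.sweep, Stmt.eliminate, Stmt.Below, Expr.Below,
      Expr.zero, Expr.one, Expr.bag, Expr.plus, Expr.mul, Expr.sum, Expr.aliveAddr, Expr.tableAddr,
      Expr.alive, Expr.table, Expr.weight, Expr.elem, Expr.rankPow, Expr.le, Expr.ne, Expr.cliques,
      Expr.size, Expr.overlap, Expr.nonadj, Expr.adj, Expr.tree, Expr.message, Expr.rowSum,
      Expr.incompat, Expr.leaf]
  -- The cells behind the input are still `0`, which reads as no remaining nodes and a zero table.
  have hrep : Represents D ∅ (fun _ _ => 0) s₃.mem := by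
    rw [hmem]
    exact ⟨hM, fun w => by simp [hzero], fun w s _ => hzero _ (by omega)⟩
  obtain ⟨w, f, hf, hT⟩ := Stmt.containsTable_main hrep hρ₃ hk
  refine (runs_assign (B := B) 0 ?_ s₄ fun j hj => (hr₄ j hj).trans_le (hr₃' j hj)).mono le_rfl
    fun s₅ ⟨_, hr₅⟩ => ?_
  · simp [Expr.Below, Expr.output, Expr.zero, Expr.plus, Expr.mul, Expr.sum, Expr.aliveAddr,
      Expr.tableAddr, Expr.alive, Expr.table]
  · rw [hr₅ 0 (by norm_num), Function.update_self, hm₄]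
    refine Expr.eval_output hf ⟨?_, ?_, ?_, ?_⟩ hT _
    · rw [hr₄ 0 (by norm_num), hρ₃.zero]
    · rw [hr₄ 1 (by norm_num), hρ₃.one]
    · rw [hr₄ 2 (by norm_num), hρ₃.two]
    · rw [hr₄ 3 (by norm_num), hρ₃.three]

end RAM

/-! ### The main theorem -/

theorem mainTheorem11 (h l : ℕ) (hh : 1 ≤ h) :
    ∃ (P : RAM.Program) (C c d : ℕ),
      ∀ (n m : ℕ) (G : SimpleGraph (Fin n)) (D : TreeDecomposition G (Fin m)),
        ∃ k : ℕ, IsMinHittingSize (cliquePlusIndep h l) G k ∧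
          RAM.OutputsWithin P (encodeInput G D) k
            (C * 2 ^ (c * D.width) * (encodeInput G D).length ^ d) := by
  obtain ⟨C, d, hC⟩ := RAM.polyBounded_hittingCost h l
  -- With `t` the width and `N` the input size, `C * (2 ^ (t + 1) * N) ^ d = (C * 2 ^ d) * 2 ^ (d *
  -- t) * N ^ d`.
  refine ⟨RAM.hittingProgram h l, C * 2 ^ d, d, d, fun n m G D => ?_⟩
  obtain ⟨k, hk⟩ := exists_isLeast_hitsCliques hh G
  have hmin := isMinHittingSize_cliquePlusIndep (l := l) hh hk
  rw [Fintype.card_fin] at hmin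
  have hN : 1 ≤ (encodeInput G D).length := by rw [length_encodeInput]; omega
  have hpow : 1 ≤ 2 ^ (D.width + 1) := Nat.one_le_two_pow
  have hB : 1 ≤ 2 ^ (D.width + 1) * (encodeInput G D).length := Nat.mul_pos hpow hN
  obtain ⟨T, s, hE, hT, hs⟩ := RAM.runs_hittingProgram h l hk
    (Nat.le_mul_of_pos_left (encodeInput G D).length hpow)
    (D.codeBound_le.trans (Nat.le_mul_of_pos_right _ hN))
  refine ⟨_, hmin, T, s, hE, (hT.trans (hC _ hB)).trans_eq ?_, hs⟩
  rw [mul_pow, ← pow_mul, add_mul, one_mul, pow_add, mul_comm D.width d]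
  ring
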